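/- Let $\mathbb{RP}^2=S^2/\{x\sim -x\}$ be the real projective plane with its standard metric, i.e. the Riemannian metric for which the covering $\pi:S^2\to\mathbb{RP}^2$ of the unit sphere is a local isometry, and let $\Delta$ be its Laplace–Beltrami operator. Let $P_m$ denote the Legendre polynomial of degree $m$, normalized by $P_m(1)=1$. For a real function $f$ put $f_+=\max(f,0)$ and $f_-=\max(-f,0)$, and let $\|\cdot\|_p$ be the $L^p$ norm with respect to the Riemannian measure of $\mathbb{RP}^2$. There are smooth, not identically zero functions $\widetilde\psi_n:\mathbb{RP}^2\to\mathbb{R}$ and real numbers $\lambda_n$ ($n\in\mathbb{N}$) with $\Delta\widetilde\psi_n=-\lambda_n\widetilde\psi_n$ for every $n$ and $\lambda_n\to\infty$ as $n\to\infty$, such that for every $p\in[6,\infty]$ the limit $$\lim_{n\to\infty}\frac{\|\widetilde\psi_{n,+}\|_p}{\|\widetilde\psi_{n,-}\|_p}$$ exists, is finite, and is greater than $1$. The sequence does not depend on $p$. Moreover, the $\widetilde\psi_n$ can be taken to be even zonal spherical harmonics descended to $\mathbb{RP}^2$: there are natural numbers $k_0<k_1<k_2<\cdots$ with $\widetilde\psi_n(\pi(x))=P_{4k_n}(x_3)$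 for all $n$ and all $x=(x_1,x_2,x_3)\in S^2$. -/

import Mathlib

open scoped ContDiff LinearAlgebra.Projectivization

noncomputable section

/-- Legendre polynomials `P_n`, as functions of `x`, given by Bonnet's recursion
`(n + 1) P_{n+1}(x) = (2 n + 1) x P_n(x) - n P_{n-1}(x)` with `P_0 = 1` and `P_1(x) = x`. -/
def legendre : ℕ → ℝ → ℝ
  | 0, _ => 1
  | 1, x => x
  | n + 2, x =>
    ((2 * (n : ℝ) + 3) * x * legendre (n + 1) x - ((n : ℝ) + 1) * legendre n x) / ((n : ℝ) + 2)

/-! ### Riemannian geometry in a coordinate plane -/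

/-- The coordinate plane `ℝ²`. -/
abbrev Plane : Type := EuclideanSpace ℝ (Fin 2)

/-- Euclidean space `ℝ³`. -/
abbrev Space : Type := EuclideanSpace ℝ (Fin 3)

/-- The partial derivative `∂F/∂u_a` of a function on the coordinate plane. -/
def partialDeriv {E : Type*} [NormedAddCommGroup E] [NormedSpace ℝ E]
    (a : Fin 2) (F : Plane → E) (u : Plane) : E :=
  fderiv ℝ F u (EuclideanSpace.single a 1)

/-- The Laplace-Beltrami operator of a Riemannian metric `g = (g_{ab})` in coordinates,
`Δ_g F = (det g)^{-1/2} ∑_a ∂_a ((det g)^{1/2} ∑_b g^{ab} ∂_b F)`. -/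
def laplaceBeltrami (g : Plane → Matrix (Fin 2) (Fin 2) ℝ) (F : Plane → ℝ) (u : Plane) : ℝ :=
  (√(g u).det)⁻¹ *
    ∑ a, partialDeriv a (fun w => √(g w).det * ∑ b, (g w)⁻¹ a b * partialDeriv b F w) u

/-! ### The real projective plane with its standard metric -/

/-- The real projective plane: lines through the origin of `ℝ³`, equivalently, points of the unit
sphere up to sign. -/
abbrev RP2 : Type := ℙ ℝ Space

/-- The quotient topology from `ℝ³ \ {0}`. -/
instance RP2.instTopologicalSpace : TopologicalSpace RP2 :=
  inferInstanceAs (TopologicalSpace (Quotient (projectivizationSetoid ℝ Space)))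

/-- The Borel `σ`-algebra. -/
instance RP2.instMeasurableSpace : MeasurableSpace RP2 := borel RP2

instance RP2.instBorelSpace : BorelSpace RP2 := ⟨rfl⟩

/-- The covering map `x ↦ [x] = {x, -x}` from the unit sphere to the projective plane. -/
def RP2.proj (x : Metric.sphere (0 : Space) 1) : RP2 :=
  Projectivization.mk ℝ (x : Space) (ne_zero_of_mem_unit_sphere x)

/-- The vector of `ℝ³` whose `i`-th coordinate is `1` and whose other two coordinates are those
of `u`, in order. -/
def RP2.affineVec (i : Fin 3) (u : Plane) : Space :=
  WithLp.toLp 2 (Fin.insertNth (α := fun _ => ℝ) i 1 u)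

theorem RP2.affineVec_ne_zero (i : Fin 3) (u : Plane) : RP2.affineVec i u ≠ 0 := by
  intro h
  have h1 := congrArg (fun v : Space => v i) h
  simp [RP2.affineVec] at h1

/-- The point of the unit sphere in the direction of `affineVec i u`. -/
def RP2.lift (i : Fin 3) (u : Plane) : Metric.sphere (0 : Space) 1 :=
  ⟨‖RP2.affineVec i u‖⁻¹ • RP2.affineVec i u, by
    simp [norm_smul, RP2.affineVec_ne_zero]⟩

/-- The three standard affine parametrizations `ℝ² → RP²`. Their images
`{[x] : x_i ≠ 0}` cover `RP²`, and they form the standard smooth atlas. -/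
def RP2.param (i : Fin 3) (u : Plane) : RP2 := RP2.proj (RP2.lift i u)

/-- The standard Riemannian metric of `RP²` in the `i`-th affine coordinates. It is the metric
for which `S² → RP²` is a local isometry, so its coefficients are the inner products in `ℝ³` of
the coordinate vector fields of the local section `lift i` of this covering. -/
def RP2.metric (i : Fin 3) (u : Plane) : Matrix (Fin 2) (Fin 2) ℝ :=
  Matrix.of fun a b =>
    inner ℝ (partialDeriv a (fun w => (RP2.lift i w : Space)) u)
      (partialDeriv b (fun w => (RP2.lift i w : Space)) u)

/-- The Riemannian measure of `RP²`, which is `(det g)^{1/2} du` in coordinates. The last affine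
chart omits only a projective line, which is a null set. -/
def RP2.area : MeasureTheory.Measure RP2 :=
  ((MeasureTheory.volume : MeasureTheory.Measure Plane).withDensity
    fun u => ENNReal.ofReal (√(RP2.metric 2 u).det)).map (RP2.param 2)

/-- `f` is an eigenfunction of the Laplacian on `RP²` with eigenvalue `lam`: it is a nonzero smooth
function with `Δ f = -lam f`. Smoothness and the equation are expressed in the charts of the
standard atlas. -/
structure RP2.IsLaplaceEigenfunction (f : RP2 → ℝ) (lam : ℝ) : Prop where
  ne_zero : f ≠ 0
  smooth : ∀ i : Fin 3, ContDiff ℝ ∞ fun u => f (RP2.param i u)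
  eigen : ∀ (i : Fin 3) (u : Plane),
    laplaceBeltrami (RP2.metric i) (fun w => f (RP2.param i w)) u = -(lam * f (RP2.param i u))

/-- The `L^p` norm on `RP²`, `1 ≤ p ≤ ∞`, for the Riemannian measure. -/
def RP2.lpNorm (p : ENNReal) (f : RP2 → ℝ) : ℝ :=
  (MeasureTheory.eLpNorm f p RP2.area).toReal

end

/-! The eigenfunctions are zonal harmonics `zonal d` of even degree d, whose positive and negative
parts differ near the pole at every scale. By Archimedes' theorem (`map_inv_affineNorm`) the height
on the projective plane is uniform on (0, 1), so the norms become norms of φ(P_d) on (0, 1) with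
φ(t) = max(t, 0) or max(-t, 0). Substituting x = 1 - 2y/(d(d+1)) multiplies them by a constant that
does not depend on φ and cancels in the ratio (`exists_eLpNorm_comp_zonal_eq`).

In the variable y, P_d converges locally uniformly to G(y) = J₀(2√y)
(`tendstoUniformlyOn_rescaledLegendre`). Sonin's monotonicity argument (`legendre_pow_four_mul_le`)
bounds all the rescaled polynomials by a multiple of y^(-1/4), which is in L^p at infinity for p >
4. Dominated convergence for p < ∞, and uniform convergence for p = ∞, give the limit ‖G₊‖_p /
‖G₋‖_p over (0, ∞) (`tendsto_eLpNorm_comp`).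

It remains to compare the parts of G (`eLpNorm_besselLimit_negPart_lt`). On [0, 1] the alternating
series gives G ≥ 1 - y, so G₋ vanishes there and ∫ G₊^p ≥ 1/(p+1). Beyond 1, |G| ≤ (9y)^(-1/4), so ∫
G₋^p ≤ 9^(-p/4)/(p/4 - 1), which is smaller when p ≥ 6. Since G(2) < 0, the denominator is positive.
-/

noncomputable section

/-! ### Legendre polynomials: recursions, differential equation, parity. -/

open Polynomial in
/-- The Legendre polynomials as elements of `ℝ[X]`. -/
def legendrePoly : ℕ → Polynomial ℝ
  | 0 => 1
  | 1 => X
  | n + 2 => C ((n : ℝ) + 2)⁻¹ *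
      (C (2 * (n : ℝ) + 3) * X * legendrePoly (n + 1) - C ((n : ℝ) + 1) * legendrePoly n)

open Polynomial in
theorem eval_legendrePoly (n : ℕ) (x : ℝ) : (legendrePoly n).eval x = legendre n x := by
  induction n using Nat.twoStepInduction with
  | zero => simp [legendrePoly, legendre]
  | one => simp [legendrePoly, legendre]
  | more n h0 h1 =>
    rw [legendrePoly, legendre]
    simp only [eval_mul, eval_sub, eval_C, eval_X, h0, h1]
    rw [div_eq_inv_mul]

/-- The derivative of the `n`-th Legendre polynomial. -/
def legendreDeriv (n : ℕ) (x : ℝ) : ℝ := (legendrePoly n).derivative.eval x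

/-- The second derivative of the `n`-th Legendre polynomial. -/
def legendreDeriv2 (n : ℕ) (x : ℝ) : ℝ := (legendrePoly n).derivative.derivative.eval x

theorem hasDerivAt_legendre (n : ℕ) (x : ℝ) :
    HasDerivAt (legendre n) (legendreDeriv n x) x := by
  have h := (legendrePoly n).hasDerivAt x
  have e : (fun x => (legendrePoly n).eval x) = legendre n :=
    funext fun x => eval_legendrePoly n x
  rwa [e] at h

theorem hasDerivAt_legendreDeriv (n : ℕ) (x : ℝ) :
    HasDerivAt (legendreDeriv n) (legendreDeriv2 n x) x :=
  (legendrePoly n).derivative.hasDerivAt x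

theorem contDiff_legendre (n : ℕ) : ContDiff ℝ ∞ (legendre n) := by
  have e : (fun x => (legendrePoly n).eval x) = legendre n :=
    funext fun x => eval_legendrePoly n x
  rw [← e]
  simpa using (legendrePoly n).contDiff_aeval (𝕜 := ℝ) (n := ∞)

theorem continuous_legendre (n : ℕ) : Continuous (legendre n) :=
  (contDiff_legendre n).continuous

theorem legendre_bonnet (n : ℕ) (x : ℝ) :
    ((n : ℝ) + 2) * legendre (n + 2) x =
      (2 * (n : ℝ) + 3) * x * legendre (n + 1) x - ((n : ℝ) + 1) * legendre n x := by
  rw [legendre]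
  field_simp

theorem legendreDeriv_bonnet (n : ℕ) (x : ℝ) :
    ((n : ℝ) + 2) * legendreDeriv (n + 2) x =
      (2 * (n : ℝ) + 3) * (legendre (n + 1) x + x * legendreDeriv (n + 1) x)
        - ((n : ℝ) + 1) * legendreDeriv n x := by
  have h1 := (hasDerivAt_legendre (n + 2) x).const_mul ((n : ℝ) + 2)
  have h2 := (((hasDerivAt_id x).mul (hasDerivAt_legendre (n + 1) x)).const_mul
    (2 * (n : ℝ) + 3)).sub ((hasDerivAt_legendre n x).const_mul ((n : ℝ) + 1))
  have e := h1.unique (h2.congr_of_eventuallyEq (Filter.Eventually.of_forall fun y => by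
    have := legendre_bonnet n y
    simp only [Pi.sub_apply, Pi.mul_apply, id]
    linarith))
  simp only [id] at e
  linarith

/-- The two identities are proved together: the inductive step of each uses both at the previous
index, with Bonnet's recursion and its derivative. -/
theorem legendreDeriv_succ_and (n : ℕ) (x : ℝ) :
    legendreDeriv (n + 1) x = x * legendreDeriv n x + ((n : ℝ) + 1) * legendre n x ∧
    ((n : ℝ) + 1) * legendre (n + 1) x = x * legendreDeriv (n + 1) x - legendreDeriv n x := by
  induction n with
  | zero => simp [legendreDeriv, legendrePoly, legendre]
  | succ n ih =>
    obtain ⟨hA, hB⟩ := ih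
    have hb := legendre_bonnet n x
    have hd := legendreDeriv_bonnet n x
    have hn : (n : ℝ) + 2 ≠ 0 := by positivity
    have hA' : legendreDeriv (n + 2) x =
        x * legendreDeriv (n + 1) x + ((n : ℝ) + 2) * legendre (n + 1) x := by
      apply mul_left_cancel₀ hn
      linear_combination hd - ((n : ℝ) + 1) * hB
    push_cast
    constructor
    · linear_combination hA'
    · linear_combination hb - x * hA' + x * hB + hA

theorem legendreDeriv_succ (n : ℕ) (x : ℝ) :
    legendreDeriv (n + 1) x = x * legendreDeriv n x + ((n : ℝ) + 1) * legendre n x :=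
  (legendreDeriv_succ_and n x).1

theorem succ_mul_legendre_succ (n : ℕ) (x : ℝ) :
    ((n : ℝ) + 1) * legendre (n + 1) x = x * legendreDeriv (n + 1) x - legendreDeriv n x :=
  (legendreDeriv_succ_and n x).2

/-- Legendre's differential equation. -/
theorem legendre_ode (n : ℕ) (x : ℝ) :
    (1 - x ^ 2) * legendreDeriv2 n x - 2 * x * legendreDeriv n x
      + (n : ℝ) * ((n : ℝ) + 1) * legendre n x = 0 := by
  cases n with
  | zero => simp [legendreDeriv, legendreDeriv2, legendrePoly]
  | succ n =>
    -- Eliminating the derivative of degree n from the two first-order identities. Differentiating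
    -- this relation, and using the second identity once more, gives the equation.
    have key : ∀ y : ℝ, (y ^ 2 - 1) * legendreDeriv (n + 1) y =
        ((n : ℝ) + 1) * (y * legendre (n + 1) y - legendre n y) := fun y => by
      have hA := legendreDeriv_succ n y
      have hB := succ_mul_legendre_succ n y
      linear_combination -hA - y * hB
    have h1 := (((hasDerivAt_id x).pow 2).sub_const 1).mul (hasDerivAt_legendreDeriv (n + 1) x)
    have h2 := (((hasDerivAt_id x).mul (hasDerivAt_legendre (n + 1) x)).sub
      (hasDerivAt_legendre n x)).const_mul ((n : ℝ) + 1)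
    have e := h1.unique (h2.congr_of_eventuallyEq (Filter.Eventually.of_forall fun y => by
      have := key y
      simp only [Pi.sub_apply, Pi.mul_apply, Pi.pow_apply, id]
      linarith))
    simp only [id, Pi.pow_apply] at e
    have hB := succ_mul_legendre_succ n x
    push_cast at e ⊢
    linear_combination -e + ((n : ℝ) + 1) * hB

theorem legendre_one (n : ℕ) : legendre n 1 = 1 := by
  induction n using Nat.twoStepInduction with
  | zero => simp [legendre]
  | one => simp [legendre]
  | more n h0 h1 =>
    rw [legendre, h0, h1]
    field_simp
    ring

theorem legendre_neg (n : ℕ) (x : ℝ) : legendre n (-x) = (-1) ^ n * legendre n x := by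
  induction n using Nat.twoStepInduction with
  | zero => simp [legendre]
  | one => simp [legendre]
  | more n h0 h1 =>
    rw [legendre, legendre, h0, h1]
    ring

theorem legendre_even_neg {n : ℕ} (hn : Even n) (x : ℝ) : legendre n (-x) = legendre n x := by
  rw [legendre_neg, hn.neg_one_pow, one_mul]

theorem legendreDeriv_even_zero {n : ℕ} (hn : Even n) : legendreDeriv n 0 = 0 := by
  have h1 := hasDerivAt_legendre n 0
  have h2 := (hasDerivAt_legendre n (-0)).comp (0 : ℝ) (hasDerivAt_neg 0)
  have e : legendre n ∘ Neg.neg = legendre n := funext fun x => legendre_even_neg hn x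
  rw [e] at h2
  have := h1.unique h2
  simp only [neg_zero] at this
  linarith

/-! ### Decay of Legendre polynomials away from the pole. -/

/-- A Wallis-type bound: Bonnet's recursion at 0 gives the ratio -(2m+1)/(2m+2), and (2m+1)²(3m+4) ≤
(2m+2)²(3m+1), with difference exactly m. The true asymptotics are 1/(πm), so the constant 3 loses
little; it becomes the 9 in the decay of the limit. -/
theorem legendre_two_mul_zero_sq_le (m : ℕ) :
    legendre (2 * m) 0 ^ 2 ≤ 1 / (3 * (m : ℝ) + 1) := by
  induction m with
  | zero => simp [legendre]
  | succ m ih =>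
    have h : legendre (2 * (m + 1)) 0 =
        -((2 * (m : ℝ) + 1) / (2 * m + 2)) * legendre (2 * m) 0 := by
      rw [show 2 * (m + 1) = 2 * m + 2 by ring, legendre]
      push_cast
      field_simp
      ring
    rw [h, mul_pow, neg_sq]
    calc ((2 * (m : ℝ) + 1) / (2 * m + 2)) ^ 2 * legendre (2 * m) 0 ^ 2
        ≤ ((2 * (m : ℝ) + 1) / (2 * m + 2)) ^ 2 * (1 / (3 * (m : ℝ) + 1)) := by gcongr
      _ ≤ 1 / (3 * ((m + 1 : ℕ) : ℝ) + 1) := by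
        push_cast
        rw [div_pow, div_mul_div_comm, div_le_div_iff₀ (by positivity) (by positivity)]
        have : (0 : ℝ) ≤ m := by positivity
        nlinarith

/-- The derivative of Sonin's function for the Legendre equation, in terms of the values
`P`, `Q` of the polynomial and of its derivative. -/
theorem sonin_identity {x P Q v D T n : ℝ} (hD : D ≠ 0)
    (hv : v = (1 - x ^ 2) * Q - x * P / 2)
    (hDd : D = (n + 1 / 2) ^ 2 * (1 - x ^ 2) + 1 / 4) (hT : T = P ^ 2 + v ^ 2 / D) :
    -(2 * x) * T ^ 2 + (1 - x ^ 2) * (2 * T * (2 * P * Q +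
      (2 * v * (-(n * (n + 1)) * P - (P + x * Q) / 2) * D
        - v ^ 2 * ((n + 1 / 2) ^ 2 * -(2 * x))) / D ^ 2)) = -(T * x * v ^ 2 / D ^ 2) := by
  have key : (1 - x ^ 2) * (2 * P * Q +
      (2 * v * (-(n * (n + 1)) * P - (P + x * Q) / 2) * D
        - v ^ 2 * ((n + 1 / 2) ^ 2 * -(2 * x))) / D ^ 2) - x * T = - (x * v ^ 2 / (2 * D ^ 2)) := by
    rw [hT]
    field_simp
    rw [hv, hDd]
    ring
  linear_combination (2 * T) * key

/-- A Bernstein-type bound, from the monotonicity of Sonin's function. -/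
theorem legendre_pow_four_mul_le {n : ℕ} (hn : Even n) {x : ℝ} (hx0 : 0 ≤ x) (hx1 : x < 1) :
    legendre n x ^ 4 * (1 - x ^ 2) ≤ legendre n 0 ^ 4 := by
  -- With x = cos θ, the function u = (sin θ)^(1/2) P(cos θ) satisfies u'' + Φu = 0, where Φ = (n +
  -- 1/2)² + 1/(4 sin² θ) = D/sin² θ and u' = -v/(sin θ)^(1/2). Sonin's function u² + u'²/Φ is then
  -- sin θ · T. Its square (1 - x²)T² is used below to avoid roots; it decreases in x because Φ
  -- grows towards the pole.
  obtain ⟨v, hv⟩ : ∃ v : ℝ → ℝ, v = fun x => (1 - x ^ 2) * legendreDeriv n x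
    - x * legendre n x / 2 := ⟨_, rfl⟩
  obtain ⟨D, hD⟩ : ∃ D : ℝ → ℝ, D = fun x => ((n : ℝ) + 1 / 2) ^ 2 * (1 - x ^ 2) + 1 / 4 :=
    ⟨_, rfl⟩
  obtain ⟨T, hT⟩ : ∃ T : ℝ → ℝ, T = fun x => legendre n x ^ 2 + v x ^ 2 / D x := ⟨_, rfl⟩
  have hDpos : ∀ y ∈ Set.Ico (0 : ℝ) 1, 0 < D y := fun y hy => by
    have : 0 ≤ 1 - y ^ 2 := by nlinarith [hy.1, hy.2]
    rw [hD]
    positivity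
  have hTnn : ∀ y ∈ Set.Ico (0 : ℝ) 1, 0 ≤ T y := fun y hy => by
    have := hDpos y hy
    rw [hT]
    positivity
  have hH : ∀ y ∈ Set.Ico (0 : ℝ) 1,
      HasDerivAt (fun x => (1 - x ^ 2) * T x ^ 2) (-(T y * y * v y ^ 2 / D y ^ 2)) y := by
    intro y hy
    have hD0 := (hDpos y hy).ne'
    have hw : HasDerivAt (fun x : ℝ => 1 - x ^ 2) (-(2 * y)) y := by
      simpa using (hasDerivAt_pow 2 y).const_sub 1
    have hv' : HasDerivAt v (-((n : ℝ) * (n + 1)) * legendre n y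
        - (legendre n y + y * legendreDeriv n y) / 2) y := by
      rw [hv]
      refine ((hw.mul (hasDerivAt_legendreDeriv n y)).sub
        (((hasDerivAt_id y).mul (hasDerivAt_legendre n y)).div_const 2)).congr_deriv ?_
      simp only [id]
      linear_combination legendre_ode n y
    have hD' : HasDerivAt D (((n : ℝ) + 1 / 2) ^ 2 * -(2 * y)) y := by
      rw [hD]
      exact (hw.const_mul _).add_const _
    have hT' : HasDerivAt T (2 * legendre n y * legendreDeriv n y +
      (2 * v y * (-((n : ℝ) * (n + 1)) * legendre n y
        - (legendre n y + y * legendreDeriv n y) / 2) * D y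
        - v y ^ 2 * (((n : ℝ) + 1 / 2) ^ 2 * -(2 * y))) / D y ^ 2) y := by
      rw [hT]
      refine (((hasDerivAt_legendre n y).pow 2).add ((hv'.pow 2).div hD' hD0)).congr_deriv ?_
      simp
    refine (hw.mul (hT'.pow 2)).congr_deriv ?_
    have := sonin_identity (x := y) (Q := legendreDeriv n y) hD0 (congrFun hv y) (congrFun hD y)
      (congrFun hT y)
    rw [← this]
    simp
  have hanti : AntitoneOn (fun x => (1 - x ^ 2) * T x ^ 2) (Set.Ico 0 1) := by
    refine antitoneOn_of_deriv_nonpos (convex_Ico 0 1)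
      (fun y hy => (hH y hy).continuousAt.continuousWithinAt)
      (fun y hy => (hH y (interior_subset hy)).differentiableAt.differentiableWithinAt) ?_
    intro y hy
    have hy' := interior_subset hy
    rw [(hH y hy').deriv, neg_nonpos]
    have := hTnn y hy'
    have := hy'.1
    positivity
  have h := hanti (Set.left_mem_Ico.2 one_pos) ⟨hx0, hx1⟩ hx0
  -- At the equator the v term drops out, since an even polynomial has zero derivative at 0.
  have hT0 : T 0 = legendre n 0 ^ 2 := by
    rw [hT, hv]
    simp [legendreDeriv_even_zero hn]
  have hTx : legendre n x ^ 2 ≤ T x := by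
    have := hDpos x ⟨hx0, hx1⟩
    rw [hT]
    simp only [le_add_iff_nonneg_right]
    positivity
  have hw : 0 ≤ 1 - x ^ 2 := by nlinarith
  calc legendre n x ^ 4 * (1 - x ^ 2) = (1 - x ^ 2) * (legendre n x ^ 2) ^ 2 := by ring
    _ ≤ (1 - x ^ 2) * T x ^ 2 := by gcongr
    _ ≤ (1 - 0 ^ 2) * T 0 ^ 2 := h
    _ = legendre n 0 ^ 4 := by rw [hT0]; ring

theorem legendre_pow_four_mul_le_div {n : ℕ} (hn : Even n) {x : ℝ} (hx0 : 0 ≤ x) (hx1 : x < 1) :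
    legendre n x ^ 4 * (1 - x ^ 2) ≤ (2 / (3 * (n : ℝ) + 2)) ^ 2 := by
  refine (legendre_pow_four_mul_le hn hx0 hx1).trans ?_
  obtain ⟨m, rfl⟩ := even_iff_two_dvd.1 hn
  have h := legendre_two_mul_zero_sq_le m
  calc legendre (2 * m) 0 ^ 4 = (legendre (2 * m) 0 ^ 2) ^ 2 := by ring
    _ ≤ (1 / (3 * (m : ℝ) + 1)) ^ 2 := by gcongr
    _ = _ := by
      push_cast
      congr 1
      field_simp

end

/-! ### Scaling limit at the pole: from Legendre to Bessel. -/

noncomputable section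

/-- The degree `n` Legendre polynomial near its pole, in the variable `y` with
`x = 1 - 2 y / (n (n + 1))`. -/
def rescaledLegendre (n : ℕ) (y : ℝ) : ℝ :=
  legendre n (1 - 2 * (y / ((n : ℝ) * ((n : ℝ) + 1))))

/-- The Taylor coefficients of `rescaledLegendre n` at `0`. -/
def rescaledCoeff (n k : ℕ) : ℝ :=
  (-1) ^ k / (k.factorial : ℝ) ^ 2 *
    ∏ j ∈ Finset.range k, (1 - (j : ℝ) * ((j : ℝ) + 1) / ((n : ℝ) * ((n : ℝ) + 1)))

/-- The Taylor coefficients of `besselLimit` at `0`. -/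
def besselCoeff (k : ℕ) : ℝ := (-1) ^ k / (k.factorial : ℝ) ^ 2

/-- The function `y ↦ J₀(2 √y)`, given by its power series. -/
def besselLimit (y : ℝ) : ℝ := ∑' k, besselCoeff k * y ^ k

theorem continuous_rescaledLegendre (n : ℕ) : Continuous (rescaledLegendre n) :=
  (continuous_legendre n).comp (by fun_prop)

theorem besselCoeff_succ (k : ℕ) : ((k : ℝ) + 1) ^ 2 * besselCoeff (k + 1) = -besselCoeff k := by
  have : (k.factorial : ℝ) ≠ 0 := by positivity
  simp only [besselCoeff, Nat.factorial_succ]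
  push_cast
  field_simp
  ring

theorem rescaledCoeff_eq (n k : ℕ) : rescaledCoeff n k = besselCoeff k *
    ∏ j ∈ Finset.range k, (1 - (j : ℝ) * ((j : ℝ) + 1) / ((n : ℝ) * ((n : ℝ) + 1))) := rfl

-- In s = (1 - x)/2 Legendre's equation is the hypergeometric equation (s(1 - s)Q')' + n(n+1)Q = 0,
-- whose power series has a two-term recursion.
open Polynomial in
theorem coeff_legendrePoly_comp_succ (n k : ℕ) :
    ((k : ℝ) + 1) ^ 2 * ((legendrePoly n).comp (1 - 2 * X)).coeff (k + 1) =
      ((k : ℝ) * (k + 1) - n * (n + 1)) * ((legendrePoly n).comp (1 - 2 * X)).coeff k := by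
  set Q := (legendrePoly n).comp (1 - 2 * X) with hQ
  have hode : derivative (X * derivative Q - X * (X * derivative Q))
      + C ((n : ℝ) * (n + 1)) * Q = 0 := by
    apply Polynomial.funext
    intro s
    have h := legendre_ode n (1 - 2 * s)
    rw [← eval_legendrePoly] at h
    simp only [legendreDeriv, legendreDeriv2] at h
    simp [hQ, derivative_comp]
    linear_combination h
  have h := congrArg (fun p => coeff p k) hode
  have hX : (X * derivative Q).coeff k = k * Q.coeff k := by
    cases k with
    | zero => simp
    | succ k => rw [coeff_X_mul, coeff_derivative]; push_cast; ring
  simp only [coeff_add, coeff_derivative, coeff_sub, coeff_X_mul, coeff_C_mul, coeff_zero, hX] at h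
  linear_combination h

open Polynomial in
theorem coeff_legendrePoly_comp {n : ℕ} (hn : n ≠ 0) (k : ℕ) :
    ((legendrePoly n).comp (1 - 2 * X)).coeff k =
      rescaledCoeff n k * ((n : ℝ) * (n + 1)) ^ k := by
  have hl : (n : ℝ) * (n + 1) ≠ 0 := by positivity
  induction k with
  | zero =>
    rw [coeff_zero_eq_eval_zero]
    simp [rescaledCoeff, eval_legendrePoly, legendre_one]
  | succ k ih =>
    have hk : ((k : ℝ) + 1) ^ 2 ≠ 0 := by positivity
    apply mul_left_cancel₀ hk
    rw [coeff_legendrePoly_comp_succ, ih, rescaledCoeff_eq, rescaledCoeff_eq,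
      Finset.prod_range_succ, pow_succ]
    have hb := besselCoeff_succ k
    generalize ∏ j ∈ Finset.range k, (1 - (j : ℝ) * ((j : ℝ) + 1) / ((n : ℝ) * ((n : ℝ) + 1))) = p
    have he : (n : ℝ) * (n + 1) * (1 - (k : ℝ) * (k + 1) / (n * (n + 1))) =
        n * (n + 1) - k * (k + 1) := by field_simp
    linear_combination (-(p * (1 - (k : ℝ) * (k + 1) / (n * (n + 1))) *
      ((n : ℝ) * (n + 1)) ^ k * (n * (n + 1)))) * hb +
      besselCoeff k * p * ((n : ℝ) * (n + 1)) ^ k * he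

theorem hasSum_rescaledLegendre {n : ℕ} (hn : n ≠ 0) (y : ℝ) :
    HasSum (fun k => rescaledCoeff n k * y ^ k) (rescaledLegendre n y) := by
  have hl : (n : ℝ) * (n + 1) ≠ 0 := by positivity
  set Q := (legendrePoly n).comp (1 - 2 * Polynomial.X) with hQ
  have hcoef : ∀ k, rescaledCoeff n k * y ^ k =
      Q.coeff k * (y / ((n : ℝ) * (n + 1))) ^ k := fun k => by
    rw [hQ, coeff_legendrePoly_comp hn, div_pow]
    field_simp
  have he : rescaledLegendre n y = Q.eval (y / ((n : ℝ) * (n + 1))) := by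
    simp [hQ, rescaledLegendre, eval_legendrePoly]
  rw [he, Polynomial.eval_eq_sum_range]
  simp_rw [hcoef]
  apply hasSum_sum_of_ne_finset_zero
  intro k hk
  rw [Polynomial.coeff_eq_zero_of_natDegree_lt (by simpa [Nat.lt_succ_iff] using hk), zero_mul]

/-- The factors with j ≤ n lie in [0, 1], and the one with j = n is zero, so the negative factors
that follow never matter. Hence the rescaled coefficients are dominated by the Bessel coefficients,
uniformly in n. -/
theorem prod_mem_Icc {n : ℕ} (hn : n ≠ 0) (k : ℕ) :
    ∏ j ∈ Finset.range k, (1 - (j : ℝ) * ((j : ℝ) + 1) / ((n : ℝ) * ((n : ℝ) + 1)))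
      ∈ Set.Icc (0 : ℝ) 1 := by
  have hl : 0 < (n : ℝ) * (n + 1) := by positivity
  rcases le_or_gt k (n + 1) with h | h
  · have h1 : ∀ j ∈ Finset.range k,
        (j : ℝ) * ((j : ℝ) + 1) / ((n : ℝ) * ((n : ℝ) + 1)) ≤ 1 := fun j hj => by
      have hj' : (j : ℝ) ≤ n := by
        have := Finset.mem_range.1 hj
        exact_mod_cast (by omega : j ≤ n)
      rw [div_le_one hl]
      gcongr
    refine ⟨Finset.prod_nonneg fun j hj => by linarith [h1 j hj],
      Finset.prod_le_one (fun j hj => by linarith [h1 j hj]) fun j hj => ?_⟩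
    have : 0 ≤ (j : ℝ) * ((j : ℝ) + 1) / ((n : ℝ) * ((n : ℝ) + 1)) := by positivity
    linarith
  · rw [Finset.prod_eq_zero (i := n) (Finset.mem_range.2 (by omega))]
    · simp
    · rw [div_self hl.ne', sub_self]

theorem abs_besselCoeff (k : ℕ) : |besselCoeff k| = 1 / (k.factorial : ℝ) ^ 2 := by
  rw [besselCoeff, abs_div, abs_pow, abs_neg, abs_one, one_pow, abs_of_nonneg (by positivity)]

theorem abs_besselCoeff_le (k : ℕ) : |besselCoeff k| ≤ 1 / (k.factorial : ℝ) := by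
  rw [abs_besselCoeff]
  have : (1 : ℝ) ≤ k.factorial := by exact_mod_cast k.factorial_pos
  gcongr
  nlinarith

theorem abs_rescaledCoeff_le {n : ℕ} (hn : n ≠ 0) (k : ℕ) :
    |rescaledCoeff n k| ≤ 1 / (k.factorial : ℝ) := by
  have h := prod_mem_Icc hn k
  rw [rescaledCoeff_eq, abs_mul, abs_of_nonneg h.1]
  calc _ ≤ |besselCoeff k| * 1 := by gcongr; exact h.2
    _ ≤ _ := by rw [mul_one]; exact abs_besselCoeff_le k

theorem tendsto_rescaledCoeff (k : ℕ) :
    Filter.Tendsto (fun n => rescaledCoeff n k) Filter.atTop (nhds (besselCoeff k)) := by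
  simp_rw [rescaledCoeff_eq]
  rw [show nhds (besselCoeff k) =
    nhds (besselCoeff k * ∏ j ∈ Finset.range k, (1 - (0 : ℝ))) by simp]
  refine (tendsto_finsetProd _ fun j _ => ?_).const_mul _
  refine Filter.Tendsto.const_sub 1 (Filter.Tendsto.const_div_atTop ?_ _)
  exact tendsto_natCast_atTop_atTop.atTop_mul_atTop₀
    (Filter.tendsto_atTop_add_const_right _ _ tendsto_natCast_atTop_atTop)

theorem summable_besselCoeff_mul_pow (y : ℝ) : Summable fun k => besselCoeff k * y ^ k := by
  refine Summable.of_norm_bounded (Real.summable_pow_div_factorial |y|) fun k => ?_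
  rw [Real.norm_eq_abs, abs_mul, abs_pow]
  calc _ ≤ 1 / (k.factorial : ℝ) * |y| ^ k := by gcongr; exact abs_besselCoeff_le k
    _ = _ := by ring

/-- On [0, R] the difference is at most ∑ |rescaledCoeff n k - besselCoeff k| R^k. This tends to 0
by dominated convergence for series, with majorant 2R^k/k!. -/
theorem tendstoUniformlyOn_rescaledLegendre (R : ℝ) :
    TendstoUniformlyOn rescaledLegendre besselLimit Filter.atTop (Set.Icc 0 R) := by
  rcases lt_or_ge R 0 with hR | hR
  · rw [Set.Icc_eq_empty_of_lt hR]
    exact tendstoUniformlyOn_empty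
  have hbound : ∀ n : ℕ, n ≠ 0 → ∀ k, ‖|rescaledCoeff n k - besselCoeff k| * R ^ k‖ ≤
      2 * (R ^ k / k.factorial) := fun n hn k => by
    rw [Real.norm_eq_abs, abs_mul, abs_abs, abs_of_nonneg (by positivity : 0 ≤ R ^ k)]
    calc _ ≤ (1 / (k.factorial : ℝ) + 1 / (k.factorial : ℝ)) * R ^ k := by
          gcongr
          exact (abs_sub _ _).trans (add_le_add (abs_rescaledCoeff_le hn k) (abs_besselCoeff_le k))
      _ = _ := by ring
  have hsum := (Real.summable_pow_div_factorial R).mul_left 2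
  have hev : ∀ᶠ n : ℕ in Filter.atTop, n ≠ 0 := Filter.eventually_ne_atTop 0
  have hlim := tendsto_tsum_of_dominated_convergence (𝓕 := Filter.atTop)
    (f := fun (n k : ℕ) => |rescaledCoeff n k - besselCoeff k| * R ^ k) (g := fun _ => 0)
    hsum (fun k => by
      have := ((tendsto_rescaledCoeff k).sub_const (besselCoeff k)).abs.mul_const (R ^ k)
      simpa using this) (hev.mono fun n hn => hbound n hn)
  rw [tsum_zero] at hlim
  rw [Metric.tendstoUniformlyOn_iff]
  intro ε hε
  filter_upwards [hlim.eventually_lt_const hε, hev] with n hn hn0 y hy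
  refine lt_of_le_of_lt ?_ hn
  rw [dist_comm, Real.dist_eq, besselLimit, ← (hasSum_rescaledLegendre hn0 y).tsum_eq,
    ← (hasSum_rescaledLegendre hn0 y).summable.tsum_sub (summable_besselCoeff_mul_pow y),
    ← Real.norm_eq_abs]
  refine tsum_of_norm_bounded (Summable.of_norm_bounded hsum (hbound n hn0)).hasSum fun k => ?_
  rw [← sub_mul, norm_mul, norm_pow, Real.norm_eq_abs, Real.norm_eq_abs, abs_of_nonneg hy.1]
  have := hy.1
  gcongr
  exact hy.2

theorem continuousOn_besselLimit : ContinuousOn besselLimit (Set.Ioi 0) := by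
  intro y hy
  have h : ContinuousOn besselLimit (Set.Icc 0 (y + 1)) :=
    (tendstoUniformlyOn_rescaledLegendre (y + 1)).continuousOn
      (Filter.Frequently.of_forall fun n => (continuous_rescaledLegendre n).continuousOn)
  exact (h.continuousAt (Icc_mem_nhds hy (by linarith))).continuousWithinAt

theorem tendsto_rescaledLegendre {y : ℝ} (hy : 0 ≤ y) :
    Filter.Tendsto (fun n => rescaledLegendre n y) Filter.atTop (nhds (besselLimit y)) :=
  (tendstoUniformlyOn_rescaledLegendre y).tendsto_at ⟨hy, le_rfl⟩

theorem abs_rescaledLegendre_le {n : ℕ} (hn : n ≠ 0) {y : ℝ} (hy : y ∈ Set.Icc (0 : ℝ) 1) :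
    |rescaledLegendre n y| ≤ Real.exp 1 := by
  rw [← (hasSum_rescaledLegendre hn y).tsum_eq, ← Real.norm_eq_abs]
  have h : HasSum (fun k : ℕ => (1 : ℝ) / k.factorial) (Real.exp 1) := by
    have := NormedSpace.expSeries_div_hasSum_exp (𝔸 := ℝ) 1
    rw [← Real.exp_eq_exp_ℝ] at this
    simpa using this
  refine tsum_of_norm_bounded h fun k => ?_
  rw [norm_mul, norm_pow, Real.norm_eq_abs, Real.norm_eq_abs]
  calc _ ≤ 1 / (k.factorial : ℝ) * 1 := by
        gcongr
        · exact abs_rescaledCoeff_le hn k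
        · exact pow_le_one₀ (abs_nonneg y) (by rw [abs_of_nonneg hy.1]; exact hy.2)
    _ = _ := mul_one _

/-- With l = n(n+1) one has 1 - x² = 4(y/l)(1 - y/l), and the condition y ≤ l/2 says x ≥ 0. The
constant is n(n+1)/(3n+2)² ≤ 1/9. -/
theorem rescaledLegendre_pow_four_mul_le {n : ℕ} (hn : n ≠ 0) (he : Even n) {y : ℝ} (hy : 0 < y)
    (hy2 : y ≤ (n : ℝ) * (n + 1) / 2) :
    rescaledLegendre n y ^ 4 * (y * (1 - y / ((n : ℝ) * (n + 1)))) ≤ 1 / 9 := by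
  have hl : 0 < (n : ℝ) * (n + 1) := by positivity
  have h1 : y / ((n : ℝ) * (n + 1)) ≤ 1 / 2 := by
    rw [div_le_div_iff₀ hl two_pos]; linarith
  have h0 : 0 < y / ((n : ℝ) * (n + 1)) := by positivity
  have h := legendre_pow_four_mul_le_div he (x := 1 - 2 * (y / ((n : ℝ) * (n + 1))))
    (by linarith) (by linarith)
  have e : rescaledLegendre n y ^ 4 * (y * (1 - y / ((n : ℝ) * (n + 1)))) =
      (n * (n + 1)) / 4 * (rescaledLegendre n y ^ 4 *
        (1 - (1 - 2 * (y / ((n : ℝ) * (n + 1)))) ^ 2)) := by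
    field_simp
    ring
  rw [e]
  calc _ ≤ (n * (n + 1)) / 4 * (2 / (3 * (n : ℝ) + 2)) ^ 2 := by gcongr; exact h
    _ ≤ 1 / 9 := by
      rw [div_pow, div_mul_div_comm, div_le_div_iff₀ (by positivity) (by positivity)]
      have : (0 : ℝ) ≤ n := by positivity
      nlinarith

theorem rescaledLegendre_pow_four_le {n : ℕ} (hn : n ≠ 0) (he : Even n) {y : ℝ} (hy : 0 < y)
    (hy2 : y ≤ (n : ℝ) * (n + 1) / 2) : rescaledLegendre n y ^ 4 ≤ 1 / y := by
  have hl : 0 < (n : ℝ) * (n + 1) := by positivity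
  have h1 : y / ((n : ℝ) * (n + 1)) ≤ 1 / 2 := by
    rw [div_le_div_iff₀ hl two_pos]; linarith
  have h := rescaledLegendre_pow_four_mul_le hn he hy hy2
  rw [le_div_iff₀ hy]
  have : rescaledLegendre n y ^ 4 * (y * (1 / 2)) ≤
      rescaledLegendre n y ^ 4 * (y * (1 - y / ((n : ℝ) * (n + 1)))) := by
    gcongr; linarith
  linarith

/-! ### Pointwise bounds on the limit function. -/

/-- The factor 1 - y/(n(n+1)) tends to 1, so the limit keeps the constant 1/9. The comparison of the
two parts needs it; the cruder bound 1/y serves only for domination. -/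
theorem besselLimit_pow_four_le {y : ℝ} (hy : 0 < y) : besselLimit y ^ 4 ≤ 1 / (9 * y) := by
  have hlam : Filter.Tendsto (fun n : ℕ => (n : ℝ) * ((n : ℝ) + 1)) Filter.atTop Filter.atTop :=
    tendsto_natCast_atTop_atTop.atTop_mul_atTop₀
      (Filter.tendsto_atTop_add_const_right _ _ tendsto_natCast_atTop_atTop)
  have h1 : Filter.Tendsto (fun n : ℕ => rescaledLegendre n y ^ 4 *
      (y * (1 - y / ((n : ℝ) * (n + 1))))) Filter.atTop
      (nhds (besselLimit y ^ 4 * (y * (1 - 0)))) :=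
    ((tendsto_rescaledLegendre hy.le).pow 4).mul
      (((hlam.const_div_atTop y).const_sub 1).const_mul y)
  have h2 : Filter.Tendsto (fun n : ℕ => 2 * (n + 1)) Filter.atTop Filter.atTop :=
    Filter.tendsto_atTop_mono (fun n => by simp only [id]; omega) Filter.tendsto_id
  have h := le_of_tendsto (h1.comp h2) (b := 1 / 9) (by
    filter_upwards [(hlam.comp h2).eventually_ge_atTop (2 * y)] with n hn
    refine rescaledLegendre_pow_four_mul_le (by omega) (even_two_mul _) hy ?_
    simp only [Function.comp_apply] at hn
    linarith)
  rw [le_div_iff₀ (by positivity)]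
  linarith

theorem antitone_pow_div_factorial_sq {y : ℝ} (hy : y ∈ Set.Icc (0 : ℝ) 1) :
    Antitone fun k : ℕ => y ^ k / (k.factorial : ℝ) ^ 2 := by
  apply antitone_nat_of_succ_le
  intro k
  have := hy.1
  have h1 : (1 : ℝ) ≤ k.factorial := by exact_mod_cast k.factorial_pos
  have h2 : (k.factorial : ℝ) ≤ (k + 1).factorial := by
    exact_mod_cast Nat.factorial_le (Nat.le_succ k)
  gcongr ?_ / ?_ ^ 2
  rw [pow_succ]
  exact mul_le_of_le_one_right (by positivity) hy.2

theorem one_sub_le_besselLimit {y : ℝ} (hy : y ∈ Set.Icc (0 : ℝ) 1) : 1 - y ≤ besselLimit y := by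
  have h := (antitone_pow_div_factorial_sq hy).alternating_series_le_tendsto (l := besselLimit y)
    (by
      have := (summable_besselCoeff_mul_pow y).hasSum.tendsto_sum_nat
      refine this.congr fun n => Finset.sum_congr rfl fun k _ => ?_
      rw [besselCoeff]; ring) 1
  simp [Finset.sum_range_succ] at h
  linarith

theorem besselLimit_two_neg : besselLimit 2 < 0 := by
  have hs := summable_besselCoeff_mul_pow 2
  have h2 := hs.sum_add_tsum_nat_add 2
  -- At y = 2 the terms 2^k/k!² start 1, 2, 1, so they are not monotone from the start. The first
  -- two are split off and the tail is bounded by its first three terms: 1 - 2 + 1 - 2/9 + 1/36 < 0.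
  have hanti : Antitone fun k : ℕ => (2 : ℝ) ^ (k + 2) / ((k + 2).factorial : ℝ) ^ 2 := by
    apply antitone_nat_of_succ_le
    intro k
    have h0 : (0 : ℝ) < (k + 2).factorial := by positivity
    rw [show k + 1 + 2 = (k + 2) + 1 by ring, Nat.factorial_succ, pow_succ, div_le_div_iff₀
      (by positivity) (by positivity)]
    push_cast
    have : (2 : ℝ) ≤ ((k : ℝ) + 2 + 1) ^ 2 := by
      have : (0 : ℝ) ≤ k := by positivity
      nlinarith
    have h3 : (0 : ℝ) ≤ 2 ^ (k + 2) * ((k + 2).factorial : ℝ) ^ 2 := by positivity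
    nlinarith
  have h := hanti.tendsto_le_alternating_series
    (l := ∑' k, besselCoeff (k + 2) * 2 ^ (k + 2))
    (by
      have := ((summable_nat_add_iff 2).2 hs).hasSum.tendsto_sum_nat
      refine this.congr fun n => Finset.sum_congr rfl fun k _ => ?_
      rw [besselCoeff]; ring) 1
  rw [besselLimit, ← h2]
  simp [Finset.sum_range_succ, besselCoeff, Nat.factorial] at h ⊢
  norm_num at h ⊢
  linarith

end

/-! ### Convergence of the L^p norms on the half-line. -/

noncomputable section

open MeasureTheory Filter Set

/-- `rescaledLegendre n`, cut off at the image of the equator. -/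
def truncatedLegendre (n : ℕ) : ℝ → ℝ :=
  (Ioo (0 : ℝ) ((n : ℝ) * (n + 1) / 2)).indicator (rescaledLegendre n)

/-- A common bound for the functions `truncatedLegendre n`. -/
def legendreEnvelope (y : ℝ) : ℝ :=
  (Ioc (0 : ℝ) 1).indicator (fun _ => Real.exp 1) y +
    (Ioi (1 : ℝ)).indicator (fun y => y ^ (-(1 / 4) : ℝ)) y

theorem abs_le_rpow_of_pow_four_le {a y : ℝ} (hy : 0 < y) (h : a ^ 4 ≤ 1 / y) :
    |a| ≤ y ^ (-(1 / 4) : ℝ) := by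
  have h4 : (y ^ (-(1 / 4) : ℝ)) ^ 4 = 1 / y := by
    rw [← Real.rpow_natCast, ← Real.rpow_mul hy.le]
    norm_num
    exact Real.rpow_neg_one y
  refine le_of_pow_le_pow_left₀ (n := 4) (by norm_num) (by positivity) ?_
  rw [h4, ← abs_pow, abs_of_nonneg (by positivity)]
  exact h

theorem legendreEnvelope_of_le_one {y : ℝ} (h0 : 0 < y) (h1 : y ≤ 1) :
    legendreEnvelope y = Real.exp 1 := by
  simp [legendreEnvelope, h0, h1]

theorem legendreEnvelope_of_one_lt {y : ℝ} (h1 : 1 < y) :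
    legendreEnvelope y = y ^ (-(1 / 4) : ℝ) := by
  simp [legendreEnvelope, h1]

theorem legendreEnvelope_nonneg (y : ℝ) : 0 ≤ legendreEnvelope y := by
  refine add_nonneg (indicator_nonneg (fun _ _ => (Real.exp_pos 1).le) y)
    (indicator_nonneg (fun z hz => ?_) y)
  have : (0 : ℝ) < z := one_pos.trans hz
  positivity

theorem abs_truncatedLegendre_le {n : ℕ} (hn : n ≠ 0) (he : Even n) {y : ℝ} (hy : 0 < y) :
    |truncatedLegendre n y| ≤ legendreEnvelope y := by
  by_cases hm : y ∈ Ioo (0 : ℝ) ((n : ℝ) * (n + 1) / 2)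
  · rw [truncatedLegendre, indicator_of_mem hm]
    rcases le_or_gt y 1 with h | h
    · rw [legendreEnvelope_of_le_one hy h]
      exact abs_rescaledLegendre_le hn ⟨hy.le, h⟩
    · rw [legendreEnvelope_of_one_lt h]
      exact abs_le_rpow_of_pow_four_le hy (rescaledLegendre_pow_four_le hn he hy hm.2.le)
  · rw [truncatedLegendre, indicator_of_notMem hm, abs_zero]
    exact legendreEnvelope_nonneg y

/-- At infinity this is integrability of y^(-p/4), which holds for p > 4. -/
theorem memLp_legendreEnvelope {p : ENNReal} (hp : 6 ≤ p) :
    MemLp legendreEnvelope p (volume.restrict (Ioi 0)) := by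
  have hp0 : p ≠ 0 := fun h => by simp [h] at hp
  refine MemLp.restrict _ (MemLp.add (memLp_indicator_const p measurableSet_Ioc _ (by simp)) ?_)
  rw [memLp_indicator_iff_restrict measurableSet_Ioi]
  have hmeas : AEStronglyMeasurable (fun y : ℝ => y ^ (-(1 / 4) : ℝ))
      (volume.restrict (Ioi 1)) := by fun_prop
  by_cases hpt : p = ⊤
  · rw [hpt]
    refine memLp_top_of_bound hmeas 1 ?_
    filter_upwards [ae_restrict_mem measurableSet_Ioi] with y hy
    have hy' : (1 : ℝ) < y := hy
    rw [Real.norm_eq_abs, abs_of_nonneg (by positivity)]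
    exact Real.rpow_le_one_of_one_le_of_nonpos hy'.le (by norm_num)
  · rw [← integrable_norm_rpow_iff hmeas hp0 hpt]
    have h6 : (6 : ℝ) ≤ p.toReal := by
      simpa using ENNReal.toReal_mono hpt hp
    refine IntegrableOn.congr_fun (integrableOn_Ioi_rpow_of_lt (a := -(1 / 4) * p.toReal)
      (by linarith) one_pos) (fun y hy => ?_) measurableSet_Ioi
    have hy' : (0 : ℝ) < y := one_pos.trans hy
    rw [Real.norm_eq_abs, abs_of_nonneg (by positivity), Real.rpow_mul hy'.le]

section limits

variable {d : ℕ → ℕ}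

theorem tendsto_mul_succ_half (hd : Tendsto d atTop atTop) :
    Tendsto (fun n => (d n : ℝ) * ((d n : ℝ) + 1) / 2) atTop atTop := by
  have h : Tendsto (fun n => (d n : ℝ)) atTop atTop := tendsto_natCast_atTop_atTop.comp hd
  exact (h.atTop_mul_atTop₀ (tendsto_atTop_add_const_right _ _ h)).atTop_div_const two_pos

theorem tendsto_truncatedLegendre (hd : Tendsto d atTop atTop) {y : ℝ} (hy : 0 < y) :
    Tendsto (fun n => truncatedLegendre (d n) y) atTop (nhds (besselLimit y)) := by
  refine ((tendsto_rescaledLegendre hy.le).comp hd).congr' ?_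
  filter_upwards [(tendsto_mul_succ_half hd).eventually_gt_atTop y] with n hn
  rw [truncatedLegendre, indicator_of_mem (mem_Ioo.2 ⟨hy, hn⟩)]
  rfl

theorem abs_besselLimit_le {y : ℝ} (hy : 0 < y) : |besselLimit y| ≤ legendreEnvelope y := by
  have hd : Tendsto (fun n => 2 * (n + 1)) atTop atTop :=
    tendsto_atTop_mono (fun n => by simp only [id]; omega) tendsto_id
  exact le_of_tendsto (tendsto_truncatedLegendre hd hy).abs
    (Eventually.of_forall fun n => abs_truncatedLegendre_le (by omega) (even_two_mul _) hy)

theorem measurable_truncatedLegendre (n : ℕ) : Measurable (truncatedLegendre n) :=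
  (continuous_rescaledLegendre n).measurable.indicator measurableSet_Ioo

theorem aestronglyMeasurable_besselLimit :
    AEStronglyMeasurable besselLimit (volume.restrict (Ioi 0)) :=
  continuousOn_besselLimit.aestronglyMeasurable measurableSet_Ioi

variable {φ : ℝ → ℝ}

/-- Both t ↦ max(t, 0) and t ↦ max(-t, 0) are 1-Lipschitz and vanish at 0, so a general such φ
treats both parts at once and preserves the envelope. -/
theorem LipschitzWith.abs_le_of_map_zero (hφ : LipschitzWith 1 φ) (h0 : φ 0 = 0) (t : ℝ) :
    |φ t| ≤ |t| := by
  simpa [h0] using hφ.dist_le_mul t 0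

theorem eLpNorm_comp_besselLimit_lt_top (hφ : LipschitzWith 1 φ) (h0 : φ 0 = 0) {p : ENNReal}
    (hp : 6 ≤ p) : eLpNorm (fun y => φ (besselLimit y)) p (volume.restrict (Ioi 0)) < ⊤ := by
  refine lt_of_le_of_lt (eLpNorm_mono_ae_real ?_) (memLp_legendreEnvelope hp).eLpNorm_lt_top
  filter_upwards [ae_restrict_mem measurableSet_Ioi] with y hy
  exact (hφ.abs_le_of_map_zero h0 _).trans (abs_besselLimit_le hy)

theorem tendsto_eLpNorm_comp_of_ne_top (hd : Tendsto d atTop atTop) (hn : ∀ n, d n ≠ 0)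
    (he : ∀ n, Even (d n)) (hφ : LipschitzWith 1 φ) (h0 : φ 0 = 0) {p : ENNReal} (hp : 6 ≤ p)
    (hpt : p ≠ ⊤) :
    Tendsto (fun n => eLpNorm (fun y => φ (truncatedLegendre (d n) y)) p
      (volume.restrict (Ioi 0))) atTop
      (nhds (eLpNorm (fun y => φ (besselLimit y)) p (volume.restrict (Ioi 0)))) := by
  have hp0 : p ≠ 0 := fun h => by simp [h] at hp
  have hfin := (memLp_legendreEnvelope hp).eLpNorm_lt_top
  simp only [eLpNorm_eq_lintegral_rpow_enorm_toReal hp0 hpt]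
  refine Tendsto.ennrpow_const _ ?_
  refine tendsto_lintegral_of_dominated_convergence
    (fun y => ‖legendreEnvelope y‖ₑ ^ p.toReal) (fun n => ?_) (fun n => ?_) ?_ ?_
  · exact ((hφ.continuous.measurable.comp (measurable_truncatedLegendre (d n))).enorm).pow_const _
  · filter_upwards [ae_restrict_mem measurableSet_Ioi] with y hy
    gcongr
    rw [enorm_le_iff_norm_le, Real.norm_eq_abs, Real.norm_eq_abs,
      abs_of_nonneg (legendreEnvelope_nonneg y)]
    exact (hφ.abs_le_of_map_zero h0 _).trans (abs_truncatedLegendre_le (hn n) (he n) hy)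
  · exact (lintegral_rpow_enorm_lt_top_of_eLpNorm_lt_top hp0 hpt hfin).ne
  · filter_upwards [ae_restrict_mem measurableSet_Ioi] with y hy
    exact (((hφ.continuous.tendsto _).comp (tendsto_truncatedLegendre hd hy)).enorm).ennrpow_const _

/-- Convergence is uniform on the whole half-line: compact sets are covered by local uniform
convergence, and on the tail both functions lie under an envelope that tends to 0. This is the
substitute for dominated convergence at p = ∞. -/
theorem eventually_abs_sub_besselLimit_le (hd : Tendsto d atTop atTop) (hn : ∀ n, d n ≠ 0)
    (he : ∀ n, Even (d n)) {ε : ℝ} (hε : 0 < ε) :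
    ∀ᶠ n in atTop, ∀ y, 0 < y → |truncatedLegendre (d n) y - besselLimit y| ≤ ε := by
  have hlim := (tendsto_rpow_neg_atTop (y := 1 / 4) (by norm_num)).eventually_le_const
    (half_pos hε)
  obtain ⟨R₀, hR₀⟩ := eventually_atTop.1 hlim
  set R := max R₀ 1
  have hunif := hd.eventually
    ((Metric.tendstoUniformlyOn_iff.1 (tendstoUniformlyOn_rescaledLegendre R)) ε hε)
  filter_upwards [hunif, (tendsto_mul_succ_half hd).eventually_gt_atTop R] with n hu hl y hy
  rcases le_or_gt y R with h | h
  · rw [truncatedLegendre, indicator_of_mem (mem_Ioo.2 ⟨hy, h.trans_lt hl⟩),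
      abs_sub_comm, ← Real.dist_eq]
    exact (hu y ⟨hy.le, h⟩).le
  · have h1 : 1 < y := (le_max_right _ _).trans_lt h
    have hB : legendreEnvelope y ≤ ε / 2 := by
      rw [legendreEnvelope_of_one_lt h1]
      exact hR₀ y ((le_max_left _ _).trans h.le)
    calc _ ≤ |truncatedLegendre (d n) y| + |besselLimit y| := abs_sub _ _
      _ ≤ ε / 2 + ε / 2 := add_le_add
        ((abs_truncatedLegendre_le (hn n) (he n) hy).trans hB) ((abs_besselLimit_le hy).trans hB)
      _ = ε := add_halves ε

theorem tendsto_eLpNorm_comp_top (hd : Tendsto d atTop atTop) (hn : ∀ n, d n ≠ 0)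
    (he : ∀ n, Even (d n)) (hφ : LipschitzWith 1 φ) (h0 : φ 0 = 0) :
    Tendsto (fun n => eLpNorm (fun y => φ (truncatedLegendre (d n) y)) ⊤
      (volume.restrict (Ioi 0))) atTop
      (nhds (eLpNorm (fun y => φ (besselLimit y)) ⊤ (volume.restrict (Ioi 0)))) := by
  have hG : AEStronglyMeasurable (fun y => φ (besselLimit y)) (volume.restrict (Ioi 0)) :=
    hφ.continuous.comp_aestronglyMeasurable aestronglyMeasurable_besselLimit
  rw [ENNReal.tendsto_nhds (eLpNorm_comp_besselLimit_lt_top hφ h0 le_top).ne]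
  intro ε hε
  -- Here ε is an extended real and may be ∞, so a real δ below it is chosen.
  obtain ⟨δ, hδ0, hδ⟩ : ∃ δ : ℝ, 0 < δ ∧ ENNReal.ofReal δ ≤ ε := by
    by_cases h : ε = ⊤
    · exact ⟨1, one_pos, by simp [h]⟩
    · exact ⟨ε.toReal, ENNReal.toReal_pos hε.ne' h, (ENNReal.ofReal_toReal h).le⟩
  filter_upwards [eventually_abs_sub_besselLimit_le hd hn he hδ0] with n hn'
  have hF : AEStronglyMeasurable (fun y => φ (truncatedLegendre (d n) y))
      (volume.restrict (Ioi 0)) :=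
    (hφ.continuous.measurable.comp (measurable_truncatedLegendre (d n))).aestronglyMeasurable
  have hb : ∀ᵐ y ∂(volume.restrict (Ioi (0 : ℝ))),
      |φ (truncatedLegendre (d n) y) - φ (besselLimit y)| ≤ δ := by
    filter_upwards [ae_restrict_mem measurableSet_Ioi] with y hy
    refine le_trans ?_ (hn' y hy)
    simpa [Real.dist_eq] using hφ.dist_le_mul (truncatedLegendre (d n) y) (besselLimit y)
  have h1 : eLpNorm ((fun y => φ (truncatedLegendre (d n) y)) - fun y => φ (besselLimit y)) ⊤
      (volume.restrict (Ioi 0)) ≤ ε := by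
    rw [eLpNorm_exponent_top]
    exact (eLpNormEssSup_le_of_ae_bound hb).trans hδ
  have h2 : eLpNorm ((fun y => φ (besselLimit y)) - fun y => φ (truncatedLegendre (d n) y)) ⊤
      (volume.restrict (Ioi 0)) ≤ ε := by
    rwa [eLpNorm_sub_comm]
  constructor
  · rw [tsub_le_iff_right]
    have := eLpNorm_add_le hF (hG.sub hF) le_top
    rw [add_sub_cancel] at this
    exact this.trans (by gcongr)
  · have := eLpNorm_add_le hG (hF.sub hG) le_top
    rw [add_sub_cancel] at this
    exact this.trans (by gcongr)

theorem tendsto_eLpNorm_comp (hd : Tendsto d atTop atTop) (hn : ∀ n, d n ≠ 0)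
    (he : ∀ n, Even (d n)) (hφ : LipschitzWith 1 φ) (h0 : φ 0 = 0) {p : ENNReal} (hp : 6 ≤ p) :
    Tendsto (fun n => eLpNorm (fun y => φ (truncatedLegendre (d n) y)) p
      (volume.restrict (Ioi 0))) atTop
      (nhds (eLpNorm (fun y => φ (besselLimit y)) p (volume.restrict (Ioi 0)))) := by
  by_cases hpt : p = ⊤
  · rw [hpt]
    exact tendsto_eLpNorm_comp_top hd hn he hφ h0
  · exact tendsto_eLpNorm_comp_of_ne_top hd hn he hφ h0 hp hpt

end limits

/-! ### Comparison of the positive and negative parts of the limit. -/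

theorem eLpNorm_besselLimit_negPart_pos {p : ENNReal} (hp : 6 ≤ p) :
    0 < eLpNorm (fun y => max (-besselLimit y) 0) p (volume.restrict (Ioi 0)) := by
  have hp0 : p ≠ 0 := fun h => by simp [h] at hp
  rw [pos_iff_ne_zero, ne_eq, eLpNorm_eq_zero_iff (by
    exact (continuous_neg.max continuous_const).comp_aestronglyMeasurable
      aestronglyMeasurable_besselLimit) hp0]
  intro h
  rw [EventuallyEq, ae_restrict_iff' measurableSet_Ioi] at h
  have hc : ContinuousAt besselLimit 2 :=
    continuousOn_besselLimit.continuousAt (Ioi_mem_nhds two_pos)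
  have hev : ∀ᶠ y in nhds (2 : ℝ), besselLimit y < 0 ∧ 0 < y :=
    (hc.eventually_lt_const besselLimit_two_neg).and (lt_mem_nhds two_pos)
  obtain ⟨U, hU, hUo, h2⟩ := eventually_nhds_iff.1 hev
  have hpos := hUo.measure_pos volume ⟨2, h2⟩
  refine hpos.ne' (measure_mono_null ?_ h)
  intro y hy hcontra
  have := hcontra (hU y hy).2
  simp at this
  linarith [(hU y hy).1]

/-- The negative part vanishes on (0, 1], where the limit is at least 1 - y; on (1, ∞) the bound
(9y)^(-1/4) is integrated. -/
theorem lintegral_besselLimit_negPart_le {q : ℝ} (hq : 6 ≤ q) :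
    ∫⁻ y in Ioi 0, ‖max (-besselLimit y) 0‖ₑ ^ q ≤
      ENNReal.ofReal (9 ^ (-(q / 4)) / (q / 4 - 1)) := by
  have hint : IntegrableOn (fun y : ℝ => (9 : ℝ) ^ (-(q / 4)) * y ^ (-(q / 4))) (Ioi 1) :=
    (integrableOn_Ioi_rpow_of_lt (by linarith) one_pos).const_mul _
  have hval : ∫ y in Ioi (1 : ℝ), (9 : ℝ) ^ (-(q / 4)) * y ^ (-(q / 4)) =
      9 ^ (-(q / 4)) / (q / 4 - 1) := by
    rw [integral_const_mul, integral_Ioi_rpow_of_lt (by linarith) one_pos, Real.one_rpow]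
    rw [show -(q / 4) + 1 = -(q / 4 - 1) by ring, neg_div_neg_eq, mul_one_div]
  rw [← hval, ofReal_integral_eq_lintegral_ofReal hint (by
    filter_upwards [ae_restrict_mem measurableSet_Ioi] with y hy
    have : (0 : ℝ) < y := one_pos.trans hy
    positivity)]
  rw [← lintegral_indicator measurableSet_Ioi, ← lintegral_indicator measurableSet_Ioi]
  refine lintegral_mono fun y => ?_
  by_cases hy : y ∈ Ioi (0 : ℝ)
  swap
  · rw [indicator_of_notMem hy]
    exact zero_le
  have hy0 : (0 : ℝ) < y := hy
  rw [indicator_of_mem hy]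
  rcases le_or_gt y 1 with h | h
  · have hG := one_sub_le_besselLimit ⟨hy0.le, h⟩
    rw [max_eq_right (by linarith), enorm_zero, ENNReal.zero_rpow_of_pos (by linarith)]
    exact zero_le
  · rw [indicator_of_mem (show y ∈ Ioi (1 : ℝ) from h), ← ofReal_norm,
      ENNReal.ofReal_rpow_of_nonneg (norm_nonneg _) (by linarith)]
    apply ENNReal.ofReal_le_ofReal
    have h1 : ‖max (-besselLimit y) 0‖ ≤ (9 * y) ^ (-(1 / 4) : ℝ) := by
      refine le_trans ?_ (abs_le_rpow_of_pow_four_le (by positivity) (besselLimit_pow_four_le hy0))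
      rw [Real.norm_eq_abs, abs_of_nonneg (le_max_right _ _)]
      exact max_le (neg_le_abs _) (abs_nonneg _)
    calc _ ≤ ((9 * y) ^ (-(1 / 4) : ℝ)) ^ q := by gcongr
      _ = (9 * y) ^ (-(q / 4)) := by
        rw [← Real.rpow_mul (by positivity)]
        congr 1
        ring
      _ = _ := Real.mul_rpow (by norm_num) hy0.le

theorem le_lintegral_besselLimit_posPart {q : ℝ} (hq : 6 ≤ q) :
    ENNReal.ofReal (1 / (q + 1)) ≤ ∫⁻ y in Ioi 0, ‖max (besselLimit y) 0‖ₑ ^ q := by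
  have hcont : Continuous fun y : ℝ => |1 - y| ^ q :=
    (by fun_prop : Continuous fun y : ℝ => |1 - y|).rpow_const fun _ => Or.inr (by linarith)
  have hval : ∫ y in Ioc (0 : ℝ) 1, |1 - y| ^ q = 1 / (q + 1) := by
    rw [← intervalIntegral.integral_of_le zero_le_one]
    have h := intervalIntegral.integral_comp_sub_left (a := 0) (b := 1)
      (fun y : ℝ => |y| ^ q) 1
    rw [h]
    simp only [sub_self, sub_zero]
    rw [intervalIntegral.integral_congr (g := fun y : ℝ => y ^ q), integral_rpow (by left; linarith)]
    · rw [Real.one_rpow, Real.zero_rpow (by linarith), sub_zero]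
    · intro y hy
      rw [uIcc_of_le zero_le_one] at hy
      simp only [abs_of_nonneg hy.1]
  rw [← hval, ofReal_integral_eq_lintegral_ofReal (hcont.integrableOn_Ioc)
    (Eventually.of_forall fun y => by positivity)]
  refine le_trans ?_ (lintegral_mono_set (s := Ioc (0 : ℝ) 1) fun y hy => hy.1)
  refine setLIntegral_mono' measurableSet_Ioc fun y hy => ?_
  have hG := one_sub_le_besselLimit ⟨hy.1.le, hy.2⟩
  rw [← ofReal_norm, ENNReal.ofReal_rpow_of_nonneg (norm_nonneg _) (by linarith)]
  apply ENNReal.ofReal_le_ofReal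
  gcongr
  rw [Real.norm_eq_abs, abs_of_nonneg (by linarith [hy.2] : 0 ≤ 1 - y),
    abs_of_nonneg (le_max_right _ _)]
  exact hG.trans (le_max_left _ _)

/-- Since q ≥ 6 gives 9^(-q/4) ≤ 9^(-3/2) = 1/27, it is enough that (q+1)/27 < q/4 - 1; at q = 6
this reads 7/27 < 1/2. -/
theorem nine_rpow_div_lt {q : ℝ} (hq : 6 ≤ q) :
    (9 : ℝ) ^ (-(q / 4)) / (q / 4 - 1) < 1 / (q + 1) := by
  have h : (9 : ℝ) ^ (-(q / 4)) ≤ 1 / 27 := by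
    calc (9 : ℝ) ^ (-(q / 4)) ≤ 9 ^ (-(3 / 2) : ℝ) :=
          Real.rpow_le_rpow_of_exponent_le (by norm_num) (by linarith)
      _ = 1 / 27 := by
        rw [show (9 : ℝ) = 3 ^ (2 : ℝ) by norm_num, ← Real.rpow_mul (by norm_num)]
        rw [show (2 : ℝ) * -(3 / 2) = ((-3 : ℤ) : ℝ) by norm_num, Real.rpow_intCast]
        norm_num
  rw [div_lt_div_iff₀ (by linarith) (by linarith)]
  nlinarith

theorem eLpNorm_besselLimit_negPart_lt {p : ENNReal} (hp : 6 ≤ p) :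
    eLpNorm (fun y => max (-besselLimit y) 0) p (volume.restrict (Ioi 0)) <
      eLpNorm (fun y => max (besselLimit y) 0) p (volume.restrict (Ioi 0)) := by
  have hp0 : p ≠ 0 := fun h => by simp [h] at hp
  by_cases hpt : p = ⊤
  · rw [hpt, eLpNorm_exponent_top, eLpNorm_exponent_top]
    -- The bound 3/5 exceeds 9^(-1/4), which bounds the negative part beyond 1. The competing 3/4
    -- below is the least value of 1 - y on (0, 1/4].
    have h1 : eLpNormEssSup (fun y => max (-besselLimit y) 0) (volume.restrict (Ioi 0)) ≤
        ENNReal.ofReal (3 / 5) := by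
      refine eLpNormEssSup_le_of_ae_bound ?_
      filter_upwards [ae_restrict_mem measurableSet_Ioi] with y hy
      have hy0 : (0 : ℝ) < y := hy
      rw [Real.norm_eq_abs, abs_of_nonneg (le_max_right _ _)]
      refine max_le ?_ (by norm_num)
      rcases le_or_gt y 1 with h | h
      · linarith [one_sub_le_besselLimit ⟨hy0.le, h⟩]
      · refine (neg_le_abs _).trans
          (le_of_pow_le_pow_left₀ (n := 4) (by norm_num) (by norm_num) ?_)
        rw [← abs_pow, abs_of_nonneg (by positivity)]
        refine (besselLimit_pow_four_le hy0).trans ?_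
        rw [div_le_iff₀ (by positivity)]
        norm_num
        linarith
    have h2 : ENNReal.ofReal (3 / 4) ≤
        eLpNormEssSup (fun y => max (besselLimit y) 0) (volume.restrict (Ioi 0)) := by
      have hne : (volume.restrict (Ioo (0 : ℝ) (1 / 4))) ≠ 0 := by
        rw [ne_eq, Measure.restrict_eq_zero]
        simp
      have hc := eLpNormEssSup_const (μ := volume.restrict (Ioo (0 : ℝ) (1 / 4))) (3 / 4 : ℝ) hne
      rw [show ENNReal.ofReal (3 / 4) = ‖(3 / 4 : ℝ)‖ₑ by
        rw [← ofReal_norm, Real.norm_of_nonneg (by norm_num)], ← hc]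
      rw [← eLpNorm_exponent_top, ← eLpNorm_exponent_top]
      refine (eLpNorm_mono_ae (g := fun y => max (besselLimit y) 0) ?_).trans
        (eLpNorm_mono_measure _ (Measure.restrict_mono_set _ Ioo_subset_Ioi_self))
      filter_upwards [ae_restrict_mem measurableSet_Ioo] with y hy
      rw [Real.norm_eq_abs, Real.norm_eq_abs, abs_of_nonneg (by norm_num),
        abs_of_nonneg (le_max_right _ _)]
      refine le_trans ?_ (le_max_left _ _)
      linarith [one_sub_le_besselLimit ⟨hy.1.le, by linarith [hy.2]⟩, hy.2]
    refine h1.trans_lt (lt_of_lt_of_le ?_ h2)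
    rw [ENNReal.ofReal_lt_ofReal_iff] <;> norm_num
  · have h6 : (6 : ℝ) ≤ p.toReal := by
      simpa using ENNReal.toReal_mono hpt hp
    rw [eLpNorm_eq_lintegral_rpow_enorm_toReal hp0 hpt,
      eLpNorm_eq_lintegral_rpow_enorm_toReal hp0 hpt]
    refine ENNReal.rpow_lt_rpow ?_ (by positivity)
    refine (lintegral_besselLimit_negPart_le h6).trans_lt
      (lt_of_lt_of_le ?_ (le_lintegral_besselLimit_posPart h6))
    rw [ENNReal.ofReal_lt_ofReal_iff (by positivity)]
    exact nine_rpow_div_lt h6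

end

/-! ### The metric and the Laplacian in the affine charts. -/

noncomputable section

/-- The squared norm of `RP2.affineVec i u`. -/
def affineSq (u : Plane) : ℝ := 1 + u 0 ^ 2 + u 1 ^ 2

theorem affineSq_pos (u : Plane) : 0 < affineSq u := by unfold affineSq; positivity

/-- The norm of `RP2.affineVec i u`. -/
def affineNorm (u : Plane) : ℝ := √(affineSq u)

theorem affineNorm_pos (u : Plane) : 0 < affineNorm u := Real.sqrt_pos.2 (affineSq_pos u)

theorem affineNorm_sq (u : Plane) : affineNorm u ^ 2 = 1 + u 0 ^ 2 + u 1 ^ 2 :=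
  Real.sq_sqrt (affineSq_pos u).le

theorem affineVec_zero_apply (u : Plane) :
    RP2.affineVec 0 u 0 = 1 ∧ RP2.affineVec 0 u 1 = u 0 ∧ RP2.affineVec 0 u 2 = u 1 :=
  ⟨rfl, rfl, rfl⟩

theorem affineVec_one_apply (u : Plane) :
    RP2.affineVec 1 u 0 = u 0 ∧ RP2.affineVec 1 u 1 = 1 ∧ RP2.affineVec 1 u 2 = u 1 :=
  ⟨rfl, rfl, rfl⟩

theorem affineVec_two_apply (u : Plane) :
    RP2.affineVec 2 u 0 = u 0 ∧ RP2.affineVec 2 u 1 = u 1 ∧ RP2.affineVec 2 u 2 = 1 :=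
  ⟨rfl, rfl, rfl⟩

theorem norm_affineVec (i : Fin 3) (u : Plane) : ‖RP2.affineVec i u‖ = affineNorm u := by
  rw [EuclideanSpace.norm_eq, affineNorm, affineSq, Fin.sum_univ_three]
  congr 1
  simp only [Real.norm_eq_abs, sq_abs]
  fin_cases i
  · obtain ⟨h0, h1, h2⟩ := affineVec_zero_apply u
    simp only [Fin.zero_eta, h0, h1, h2]
    ring
  · obtain ⟨h0, h1, h2⟩ := affineVec_one_apply u
    simp only [Fin.mk_one, h0, h1, h2]
    ring
  · obtain ⟨h0, h1, h2⟩ := affineVec_two_apply u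
    simp only [Fin.reduceFinMk, h0, h1, h2]
    ring

theorem contDiff_coord (a : Fin 2) : ContDiff ℝ ∞ fun u : Plane => u a := by fun_prop

theorem contDiff_affineNorm : ContDiff ℝ ∞ affineNorm := by
  unfold affineNorm
  refine ContDiff.sqrt ?_ fun u => (affineSq_pos u).ne'
  unfold affineSq
  fun_prop

theorem differentiableAt_affineNorm (u : Plane) : DifferentiableAt ℝ affineNorm u :=
  contDiff_affineNorm.differentiable (by simp) u

theorem partialDeriv_coord (a b : Fin 2) (u : Plane) :
    partialDeriv a (fun w : Plane => w b) u = if b = a then 1 else 0 := by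
  have h : HasFDerivAt (fun w : Plane => w b)
      (EuclideanSpace.proj b : Plane →L[ℝ] ℝ) u :=
    (EuclideanSpace.proj b : Plane →L[ℝ] ℝ).hasFDerivAt
  rw [partialDeriv, h.fderiv]
  simp

theorem partialDeriv_mul {a : Fin 2} {F G : Plane → ℝ} {u : Plane}
    (hF : DifferentiableAt ℝ F u) (hG : DifferentiableAt ℝ G u) :
    partialDeriv a (fun w => F w * G w) u =
      F u * partialDeriv a G u + G u * partialDeriv a F u := by
  simp [partialDeriv, fderiv_fun_mul hF hG]

theorem partialDeriv_comp {a : Fin 2} {f : ℝ → ℝ} {f' : ℝ} {F : Plane → ℝ} {u : Plane}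
    (hf : HasDerivAt f f' (F u)) (hF : DifferentiableAt ℝ F u) :
    partialDeriv a (fun w => f (F w)) u = f' * partialDeriv a F u := by
  have : HasFDerivAt (fun w => f (F w)) (f' • fderiv ℝ F u) u :=
    hf.comp_hasFDerivAt u hF.hasFDerivAt
  rw [partialDeriv, HasFDerivAt.fderiv this]
  simp [partialDeriv]

theorem partialDeriv_affineNorm (a : Fin 2) (u : Plane) :
    partialDeriv a affineNorm u = u a / affineNorm u := by
  have h2 : partialDeriv a (fun w => affineNorm w * affineNorm w) u = 2 * u a := by
    have e : (fun w => affineNorm w * affineNorm w) = fun w : Plane => 1 + w 0 ^ 2 + w 1 ^ 2 :=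
      funext fun w => by rw [← affineNorm_sq]; ring
    have h0 : HasFDerivAt (fun w : Plane => w 0) (EuclideanSpace.proj 0 : Plane →L[ℝ] ℝ) u :=
      (EuclideanSpace.proj 0 : Plane →L[ℝ] ℝ).hasFDerivAt
    have h1 : HasFDerivAt (fun w : Plane => w 1) (EuclideanSpace.proj 1 : Plane →L[ℝ] ℝ) u :=
      (EuclideanSpace.proj 1 : Plane →L[ℝ] ℝ).hasFDerivAt
    rw [e, partialDeriv]
    refine (congrArg (fun L => L (EuclideanSpace.single a 1))
      (((h0.pow 2).const_add 1).add (h1.pow 2)).fderiv).trans ?_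
    fin_cases a <;> simp
  rw [partialDeriv_mul (differentiableAt_affineNorm u) (differentiableAt_affineNorm u)] at h2
  have := (affineNorm_pos u).ne'
  field_simp
  linarith

theorem partialDeriv_affineNorm_inv_pow (m : ℕ) (a : Fin 2) (u : Plane) :
    partialDeriv a (fun w => (affineNorm w ^ m)⁻¹) u = -(m * u a / affineNorm u ^ (m + 2)) := by
  have h0 := (affineNorm_pos u).ne'
  have := partialDeriv_comp (a := a) (((hasDerivAt_pow m (affineNorm u)).inv (pow_ne_zero m h0)))
    (differentiableAt_affineNorm u)
  simp only [Pi.inv_apply] at this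
  rw [this, partialDeriv_affineNorm]
  cases m with
  | zero => simp
  | succ m =>
    simp only [Nat.add_sub_cancel]
    field_simp
    ring

theorem partialDeriv_apply {a : Fin 2} {F : Plane → Space} {u : Plane}
    (hF : DifferentiableAt ℝ F u) (j : Fin 3) :
    partialDeriv a F u j = partialDeriv a (fun w => F w j) u := by
  have h : HasFDerivAt (fun w => F w j)
      ((EuclideanSpace.proj j : Space →L[ℝ] ℝ).comp (fderiv ℝ F u)) u :=
    (EuclideanSpace.proj j : Space →L[ℝ] ℝ).hasFDerivAt.comp u hF.hasFDerivAt
  rw [partialDeriv, partialDeriv, h.fderiv]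
  rfl

theorem contDiff_affineNorm_inv_pow (m : ℕ) : ContDiff ℝ ∞ fun w => (affineNorm w ^ m)⁻¹ :=
  (contDiff_affineNorm.pow m).inv fun w => pow_ne_zero m (affineNorm_pos w).ne'

theorem differentiableAt_affineNorm_inv_pow (m : ℕ) (u : Plane) :
    DifferentiableAt ℝ (fun w => (affineNorm w ^ m)⁻¹) u :=
  (contDiff_affineNorm_inv_pow m).differentiable (by simp) u

theorem differentiableAt_coord (a : Fin 2) (u : Plane) :
    DifferentiableAt ℝ (fun w : Plane => w a) u :=
  (contDiff_coord a).differentiable (by simp) u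

theorem partialDeriv_coord_mul_affineNorm_inv_pow (m : ℕ) (a b : Fin 2) (u : Plane) :
    partialDeriv a (fun w => w b * (affineNorm w ^ m)⁻¹) u =
      (if b = a then 1 else 0) / affineNorm u ^ m - m * u a * u b / affineNorm u ^ (m + 2) := by
  rw [partialDeriv_mul (differentiableAt_coord b u) (differentiableAt_affineNorm_inv_pow m u),
    partialDeriv_affineNorm_inv_pow, partialDeriv_coord]
  ring

theorem lift_apply (i : Fin 3) (u : Plane) (j : Fin 3) :
    (RP2.lift i u : Space) j = (affineNorm u)⁻¹ * RP2.affineVec i u j := by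
  rw [← norm_affineVec i u]
  rfl

theorem contDiff_affineVec_apply (i j : Fin 3) : ContDiff ℝ ∞ fun u => RP2.affineVec i u j := by
  fin_cases i <;> fin_cases j <;>
    first | exact contDiff_const | exact contDiff_coord 0 | exact contDiff_coord 1

theorem contDiff_lift_apply (i j : Fin 3) :
    ContDiff ℝ ∞ fun u => (RP2.lift i u : Space) j := by
  simp_rw [lift_apply]
  exact (contDiff_affineNorm.inv fun u => (affineNorm_pos u).ne').mul
    (contDiff_affineVec_apply i j)

theorem contDiff_lift (i : Fin 3) : ContDiff ℝ ∞ fun u => (RP2.lift i u : Space) := by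
  rw [contDiff_euclidean]
  exact contDiff_lift_apply i

theorem metric_apply (i : Fin 3) (u : Plane) (a b : Fin 2) :
    RP2.metric i u a b =
      (if a = b then 1 else 0) / affineNorm u ^ 2 - u a * u b / affineNorm u ^ 4 := by
  have hd : DifferentiableAt ℝ (fun w => (RP2.lift i w : Space)) u :=
    (contDiff_lift i).differentiable (by simp) u
  have h0 := (affineNorm_pos u).ne'
  have hsq := affineNorm_sq u
  have hone : ∀ c : Fin 2, partialDeriv c (fun w => (affineNorm w)⁻¹) u =
      -(u c / affineNorm u ^ 3) := fun c => by
    have := partialDeriv_affineNorm_inv_pow 1 c u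
    simpa using this
  have hco : ∀ c e : Fin 2, partialDeriv c (fun w => w e * (affineNorm w)⁻¹) u =
      (if e = c then 1 else 0) / affineNorm u - u c * u e / affineNorm u ^ 3 := fun c e => by
    have := partialDeriv_coord_mul_affineNorm_inv_pow 1 c e u
    simpa using this
  have key : RP2.metric i u a b = ∑ j : Fin 3,
      partialDeriv b (fun w => RP2.affineVec i w j * (affineNorm w)⁻¹) u *
        partialDeriv a (fun w => RP2.affineVec i w j * (affineNorm w)⁻¹) u := by
    simp_rw [RP2.metric, Matrix.of_apply, PiLp.inner_apply, partialDeriv_apply hd, lift_apply,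
      mul_comm (affineNorm _)⁻¹]
    rfl
  -- The coordinate of `affineVec` equal to 1 contributes the first term and the other two the sum.
  -- The charts differ only in the order of these coordinates, so all have the same metric
  -- coefficients.
  have main : RP2.metric i u a b = u a * u b / affineNorm u ^ 6 +
      ∑ e : Fin 2, ((if e = a then 1 else 0) / affineNorm u - u a * u e / affineNorm u ^ 3) *
        ((if e = b then 1 else 0) / affineNorm u - u b * u e / affineNorm u ^ 3) := by
    rw [key, Fin.sum_univ_three, Fin.sum_univ_two]
    fin_cases i
    · simp only [Fin.zero_eta, fun w => (affineVec_zero_apply w).1,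
        fun w => (affineVec_zero_apply w).2.1, fun w => (affineVec_zero_apply w).2.2, one_mul,
        hone, hco]
      ring
    · simp only [Fin.mk_one, fun w => (affineVec_one_apply w).1,
        fun w => (affineVec_one_apply w).2.1, fun w => (affineVec_one_apply w).2.2, one_mul,
        hone, hco]
      ring
    · simp only [Fin.reduceFinMk, fun w => (affineVec_two_apply w).1,
        fun w => (affineVec_two_apply w).2.1, fun w => (affineVec_two_apply w).2.2, one_mul,
        hone, hco]
      ring
  rw [main, Fin.sum_univ_two]
  fin_cases a <;> fin_cases b <;> simp <;> field_simp
  · linear_combination (u 0 ^ 2) * (-hsq)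
  · linear_combination (u 0 * u 1) * (-hsq)
  · linear_combination (u 0 * u 1) * (-hsq)
  · linear_combination (u 1 ^ 2) * (-hsq)

theorem det_metric (i : Fin 3) (u : Plane) : (RP2.metric i u).det = ((affineNorm u ^ 3)⁻¹) ^ 2 := by
  have h0 := (affineNorm_pos u).ne'
  have hsq := affineNorm_sq u
  rw [Matrix.det_fin_two]
  simp only [metric_apply]
  simp
  field_simp
  linear_combination affineNorm u ^ 2 * hsq

theorem sqrt_det_metric (i : Fin 3) (u : Plane) :
    √(RP2.metric i u).det = (affineNorm u ^ 3)⁻¹ := by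
  have := affineNorm_pos u
  rw [det_metric, Real.sqrt_sq (by positivity)]

theorem inv_metric (i : Fin 3) (u : Plane) :
    (RP2.metric i u)⁻¹ = Matrix.of fun a b =>
      affineNorm u ^ 2 * ((if a = b then 1 else 0) + u a * u b) := by
  have h0 := (affineNorm_pos u).ne'
  have hsq := affineNorm_sq u
  apply Matrix.inv_eq_right_inv
  ext a b
  rw [Matrix.mul_apply, Fin.sum_univ_two]
  simp only [metric_apply, Matrix.of_apply]
  fin_cases a <;> fin_cases b <;> simp <;> field_simp
  · linear_combination (u 0 ^ 2) * hsq
  · linear_combination (u 0 * u 1) * hsq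
  · linear_combination (u 0 * u 1) * hsq
  · linear_combination (u 1 ^ 2) * hsq

/-- The Laplace-Beltrami operator on a function of a coordinate `h` of the sphere, from the field
`W`, which is the gradient of `h` times the density of the area. -/
theorem laplaceBeltrami_legendre_comp (i : Fin 3) (n : ℕ) {h : Plane → ℝ}
    {W : Fin 2 → Plane → ℝ} (hh : Differentiable ℝ h) (hW : ∀ a, Differentiable ℝ (W a))
    (hgrad : ∀ a w, W a w = (affineNorm w)⁻¹ *
      (partialDeriv a h w + w a * (w 0 * partialDeriv 0 h w + w 1 * partialDeriv 1 h w)))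
    {u : Plane}
    (hnorm : affineNorm u ^ 3 * (W 0 u * partialDeriv 0 h u + W 1 u * partialDeriv 1 h u) =
      1 - h u ^ 2)
    (hdiv : affineNorm u ^ 3 * (partialDeriv 0 (W 0) u + partialDeriv 1 (W 1) u) = -(2 * h u)) :
    laplaceBeltrami (RP2.metric i) (fun w => legendre n (h w)) u =
      -((n : ℝ) * (n + 1) * legendre n (h u)) := by
  have hF : ∀ b w, partialDeriv b (fun w => legendre n (h w)) w =
      legendreDeriv n (h w) * partialDeriv b h w := fun b w =>
    partialDeriv_comp (hasDerivAt_legendre n (h w)) (hh w)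
  have hfield : ∀ a, (fun w => √(RP2.metric i w).det * ∑ b, (RP2.metric i w)⁻¹ a b *
      partialDeriv b (fun w => legendre n (h w)) w) =
      fun w => legendreDeriv n (h w) * W a w := fun a => by
    funext w
    have h0 := (affineNorm_pos w).ne'
    simp only [sqrt_det_metric, inv_metric, Matrix.of_apply, hF, Fin.sum_univ_two, hgrad]
    fin_cases a <;> simp <;> field_simp <;> ring
  have hpd : ∀ a, partialDeriv a (fun w => legendreDeriv n (h w) * W a w) u =
      legendreDeriv n (h u) * partialDeriv a (W a) u +
        W a u * (legendreDeriv2 n (h u) * partialDeriv a h u) := fun a => by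
    rw [partialDeriv_mul _ (hW a u), partialDeriv_comp (hasDerivAt_legendreDeriv n (h u)) (hh u)]
    exact (hasDerivAt_legendreDeriv n (h u)).differentiableAt.comp u (hh u)
  rw [laplaceBeltrami, Fin.sum_univ_two]
  simp only [hfield, hpd]
  rw [sqrt_det_metric, inv_inv]
  -- The chain rule gives Δ P(h) = P''(h)|∇h|² + P'(h)Δh. With |∇h|² = 1 - h² and Δh = -2h this is
  -- Legendre's equation at h.
  linear_combination legendreDeriv2 n (h u) * hnorm + legendreDeriv n (h u) * hdiv +
    legendre_ode n (h u)

/-- The function 1/`affineNorm` is the height x₃ in the last chart. The exponent 1 matches the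
derivative lemmas for inverse powers. -/
theorem laplaceBeltrami_legendre_inv_affineNorm (n : ℕ) (i : Fin 3) (u : Plane) :
    laplaceBeltrami (RP2.metric i) (fun w => legendre n ((affineNorm w ^ 1)⁻¹)) u =
      -((n : ℝ) * (n + 1) * legendre n ((affineNorm u ^ 1)⁻¹)) := by
  have h0 := (affineNorm_pos u).ne'
  have hsq := affineNorm_sq u
  refine laplaceBeltrami_legendre_comp i n (h := fun w => (affineNorm w ^ 1)⁻¹)
    (W := fun a w => -1 * (w a * (affineNorm w ^ 2)⁻¹))
    (differentiableAt_affineNorm_inv_pow 1)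
    (fun a w => ((differentiableAt_coord a w).mul
      (differentiableAt_affineNorm_inv_pow 2 w)).const_mul _) (fun a w => ?_) ?_ ?_
  · have hw0 := (affineNorm_pos w).ne'
    have hwsq := affineNorm_sq w
    simp only [partialDeriv_affineNorm_inv_pow]
    push_cast
    field_simp
    linear_combination -(w a) * hwsq
  · simp only [partialDeriv_affineNorm_inv_pow]
    push_cast
    field_simp
    linear_combination -hsq
  · have hc : ∀ a, partialDeriv a (fun w => -1 * (w a * (affineNorm w ^ 2)⁻¹)) u =
        -(1 / affineNorm u ^ 2 - 2 * u a * u a / affineNorm u ^ 4) := fun a => by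
      rw [partialDeriv_mul (G := fun w => w a * (affineNorm w ^ 2)⁻¹) (differentiableAt_const _)
        ((differentiableAt_coord a u).mul (differentiableAt_affineNorm_inv_pow 2 u)), partialDeriv_coord_mul_affineNorm_inv_pow]
      simp [partialDeriv]
    simp only [hc]
    field_simp
    linear_combination (-2 : ℝ) * hsq

/-- The height x₃ in the other two charts, where it is the second affine coordinate divided by the
norm. -/
theorem laplaceBeltrami_legendre_coord (n : ℕ) (i : Fin 3) (u : Plane) :
    laplaceBeltrami (RP2.metric i) (fun w => legendre n (w 1 * (affineNorm w ^ 1)⁻¹)) u =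
      -((n : ℝ) * (n + 1) * legendre n (u 1 * (affineNorm u ^ 1)⁻¹)) := by
  have h0 := (affineNorm_pos u).ne'
  refine laplaceBeltrami_legendre_comp i n (h := fun w => w 1 * (affineNorm w ^ 1)⁻¹)
    (W := fun a w => (if (1 : Fin 2) = a then 1 else 0) * (affineNorm w ^ 2)⁻¹)
    (fun w => (differentiableAt_coord 1 w).mul (differentiableAt_affineNorm_inv_pow 1 w))
    (fun a w => (differentiableAt_affineNorm_inv_pow 2 w).const_mul _) (fun a w => ?_) ?_ ?_
  · have hw0 := (affineNorm_pos w).ne'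
    have hwsq := affineNorm_sq w
    simp only [partialDeriv_coord_mul_affineNorm_inv_pow]
    fin_cases a
    · simp
      right
      field_simp
      linear_combination (w 0 * w 1) * hwsq
    · simp
      field_simp
      linear_combination -(w 1 ^ 2) * hwsq
  · simp only [partialDeriv_coord_mul_affineNorm_inv_pow]
    simp
    field_simp
  · have hc : ∀ a, partialDeriv a
        (fun w => (if (1 : Fin 2) = a then 1 else 0) * (affineNorm w ^ 2)⁻¹) u =
        (if (1 : Fin 2) = a then 1 else 0) * -(2 * u a / affineNorm u ^ 4) := fun a => by
      rw [partialDeriv_mul (F := fun _ => if (1 : Fin 2) = a then 1 else 0)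
        (differentiableAt_const _) (differentiableAt_affineNorm_inv_pow 2 u),
        partialDeriv_affineNorm_inv_pow]
      simp [partialDeriv]
    beta_reduce
    rw [hc 0, hc 1]
    simp
    field_simp

/-! ### Zonal harmonics as eigenfunctions. -/

/-- The zonal harmonic of even degree `n` on the projective plane. -/
def zonal (n : ℕ) (q : RP2) : ℝ := legendre n (q.rep 2 / ‖q.rep‖)

/-- The chosen representative is a nonzero multiple of v, which changes v₂/‖v‖ at most by a sign;
evenness absorbs it. -/
theorem zonal_mk {n : ℕ} (hn : Even n) (v : Space) (hv : v ≠ 0) :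
    zonal n (Projectivization.mk ℝ v hv) = legendre n (v 2 / ‖v‖) := by
  obtain ⟨a, ha⟩ := Projectivization.exists_smul_eq_mk_rep ℝ v hv
  have ha0 : (a : ℝ) ≠ 0 := a.ne_zero
  have hv0 : ‖v‖ ≠ 0 := norm_ne_zero_iff.2 hv
  rw [zonal, ← ha, Units.smul_def, norm_smul, PiLp.smul_apply, Real.norm_eq_abs, smul_eq_mul]
  rcases lt_or_gt_of_ne ha0 with h | h
  · rw [abs_of_neg h, ← legendre_even_neg hn]
    congr 1
    field_simp
  · rw [abs_of_pos h]
    congr 1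
    field_simp

theorem zonal_proj {n : ℕ} (hn : Even n) (x : Metric.sphere (0 : Space) 1) :
    zonal n (RP2.proj x) = legendre n ((x : Space) 2) := by
  rw [RP2.proj, zonal_mk hn, norm_eq_of_mem_sphere, div_one]

theorem zonal_param {n : ℕ} (hn : Even n) (i : Fin 3) (u : Plane) :
    zonal n (RP2.param i u) = legendre n ((RP2.lift i u : Space) 2) :=
  zonal_proj hn _

theorem isLaplaceEigenfunction_zonal {n : ℕ} (hn : Even n) :
    RP2.IsLaplaceEigenfunction (zonal n) ((n : ℝ) * (n + 1)) where
  ne_zero h := by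
    have h1 := congrFun h (RP2.param 2 0)
    rw [zonal_param hn, lift_apply, (affineVec_two_apply 0).2.2] at h1
    have : affineNorm 0 = 1 := by simp [affineNorm, affineSq]
    rw [this] at h1
    simp [legendre_one] at h1
  smooth i := by
    simp_rw [zonal_param hn]
    exact (contDiff_legendre n).comp (contDiff_lift_apply i 2)
  eigen i u := by
    simp_rw [zonal_param hn, lift_apply]
    fin_cases i
    · simp only [Fin.zero_eta, fun w => (affineVec_zero_apply w).2.2]
      have := laplaceBeltrami_legendre_coord n 0 u
      simpa only [pow_one, mul_comm (affineNorm _)⁻¹] using this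
    · simp only [Fin.mk_one, fun w => (affineVec_one_apply w).2.2]
      have := laplaceBeltrami_legendre_coord n 1 u
      simpa only [pow_one, mul_comm (affineNorm _)⁻¹] using this
    · simp only [Fin.reduceFinMk, fun w => (affineVec_two_apply w).2.2]
      have := laplaceBeltrami_legendre_inv_affineNorm n 2 u
      simpa only [pow_one, mul_one] using this

end

/-! ### Distribution of the height and transfer of the norms to the half-line. -/

noncomputable section

open MeasureTheory Filter Set Metric

/-- Polar coordinates: away from 0 the Haar measure is the product of the sphere measure and r^(dim
- 1) dr. -/
theorem lintegral_fun_norm_addHaar {E : Type*} [NormedAddCommGroup E] [NormedSpace ℝ E]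
    [MeasurableSpace E] [Nontrivial E] (μ : Measure E) [FiniteDimensional ℝ E] [BorelSpace E]
    [μ.IsAddHaarMeasure] {f : ℝ → ENNReal} (hf : Measurable f) :
    ∫⁻ x, f ‖x‖ ∂μ = μ.toSphere univ *
      ∫⁻ y in Ioi (0 : ℝ), ENNReal.ofReal (y ^ (Module.finrank ℝ E - 1)) * f y :=
  calc ∫⁻ x, f ‖x‖ ∂μ = ∫⁻ x : ({(0)}ᶜ : Set E), f (‖x.1‖) ∂(μ.comap (↑)) := by
        rw [lintegral_subtype_comap (measurableSet_singleton _).compl fun x => f ‖x‖,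
          restrict_compl_singleton]
    _ = ∫⁻ x, f x.2 ∂μ.toSphere.prod (.volumeIoiPow (Module.finrank ℝ E - 1)) := by
        refine Eq.trans ?_ (μ.measurePreserving_homeomorphUnitSphereProd.lintegral_comp_emb
          (Homeomorph.measurableEmbedding _) (f ∘ Subtype.val ∘ Prod.snd))
        simp
    _ = μ.toSphere univ * ∫⁻ x : Ioi (0 : ℝ), f x ∂.volumeIoiPow (Module.finrank ℝ E - 1) := by
        rw [lintegral_prod _ (by fun_prop)]
        simp [mul_comm]
    _ = _ := by
        rw [Measure.volumeIoiPow, lintegral_withDensity_eq_lintegral_mul _ (by fun_prop)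
          (by fun_prop)]
        congr 1
        exact lintegral_subtype_comap measurableSet_Ioi
          fun y : ℝ => ENNReal.ofReal (y ^ (Module.finrank ℝ E - 1)) * f y

theorem image_inv_sqrt_one_add_sq :
    (fun s : ℝ => (√(1 + s ^ 2))⁻¹) '' Ioi 0 = Ioo 0 1 := by
  ext x
  constructor
  · rintro ⟨s, hs, rfl⟩
    have hs' : (0 : ℝ) < s := hs
    have h : 1 < √(1 + s ^ 2) := by
      rw [Real.lt_sqrt zero_le_one]
      nlinarith
    exact ⟨by positivity, inv_lt_one_of_one_lt₀ h⟩
  · rintro ⟨h0, h1⟩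
    have h2 : 1 < x⁻¹ := (one_lt_inv₀ h0).2 h1
    refine ⟨√((x⁻¹) ^ 2 - 1), Real.sqrt_pos.2 (by nlinarith), ?_⟩
    simp only
    rw [Real.sq_sqrt (by nlinarith), add_sub_cancel, Real.sqrt_sq (by positivity), inv_inv]

theorem hasDerivAt_inv_sqrt_one_add_sq (s : ℝ) :
    HasDerivAt (fun s : ℝ => (√(1 + s ^ 2))⁻¹) (-(s * (√(1 + s ^ 2) ^ 3)⁻¹)) s := by
  have hpos : 0 < 1 + s ^ 2 := by positivity
  have h1 : HasDerivAt (fun s : ℝ => 1 + s ^ 2) (2 * s) s := by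
    simpa using (hasDerivAt_pow 2 s).const_add 1
  have hr : √(1 + s ^ 2) ≠ 0 := (Real.sqrt_pos.2 hpos).ne'
  refine ((h1.sqrt hpos.ne').inv hr).congr_deriv ?_
  field_simp

theorem injOn_inv_sqrt_one_add_sq :
    InjOn (fun s : ℝ => (√(1 + s ^ 2))⁻¹) (Ioi 0) := by
  intro s hs t ht h
  have hs' : (0 : ℝ) < s := hs
  have ht' : (0 : ℝ) < t := ht
  have h' := inv_injective h
  rw [Real.sqrt_inj (by positivity) (by positivity)] at h'
  exact (pow_left_inj₀ hs'.le ht'.le two_ne_zero).1 (by linarith)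

/-- The substitution x = 1/√(1 + s²). Its Jacobian s(1 + s²)^(-3/2) is exactly the polar factor s
times the area density of the affine chart, which is why the height is uniformly distributed. -/
theorem lintegral_Ioo_eq_lintegral_Ioi (f : ℝ → ENNReal) :
    ∫⁻ x in Ioo 0 1, f x = ∫⁻ s in Ioi (0 : ℝ),
      ENNReal.ofReal (s * (√(1 + s ^ 2) ^ 3)⁻¹) * f (√(1 + s ^ 2))⁻¹ := by
  rw [← image_inv_sqrt_one_add_sq, lintegral_image_eq_lintegral_abs_deriv_mul measurableSet_Ioi
    (fun s _ => (hasDerivAt_inv_sqrt_one_add_sq s).hasDerivWithinAt) injOn_inv_sqrt_one_add_sq]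
  refine setLIntegral_congr_fun measurableSet_Ioi fun s hs => ?_
  have hs' : (0 : ℝ) < s := hs
  rw [abs_neg, abs_of_nonneg (by positivity)]

theorem affineNorm_eq (u : Plane) : affineNorm u = √(1 + ‖u‖ ^ 2) := by
  rw [affineNorm, affineSq, EuclideanSpace.norm_sq_eq, Fin.sum_univ_two]
  simp only [Real.norm_eq_abs, sq_abs, add_assoc]

theorem RP2.continuous_mk :
    Continuous fun v : { v : Space // v ≠ 0 } => (Projectivization.mk ℝ v.1 v.2 : RP2) :=
  continuous_quotient_mk'

theorem RP2.continuous_iff {X : Type*} [TopologicalSpace X] {f : RP2 → X} :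
    Continuous f ↔
      Continuous fun v : { v : Space // v ≠ 0 } => f (Projectivization.mk ℝ v.1 v.2) :=
  continuous_coinduced_dom

theorem RP2.continuous_param (i : Fin 3) : Continuous (RP2.param i) :=
  RP2.continuous_mk.comp (Continuous.subtype_mk (contDiff_lift i).continuous
    fun u => ne_zero_of_mem_unit_sphere (RP2.lift i u))

theorem continuous_zonal {n : ℕ} (hn : Even n) : Continuous (zonal n) := by
  rw [RP2.continuous_iff]
  simp_rw [zonal_mk hn]
  refine (continuous_legendre n).comp (Continuous.div ?_ ?_ fun v => norm_ne_zero_iff.2 v.2)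
  · fun_prop
  · fun_prop

theorem continuous_affineNorm : Continuous affineNorm := contDiff_affineNorm.continuous

/-- Archimedes' theorem: the height of a random point of the projective plane is uniform. -/
theorem map_inv_affineNorm :
    ((volume : Measure Plane).withDensity
      fun u => ENNReal.ofReal (√(RP2.metric 2 u).det)).map (fun u => (affineNorm u)⁻¹) =
      (volume : Measure Plane).toSphere univ • volume.restrict (Ioo (0 : ℝ) 1) := by
  have hm : Measurable fun u : Plane => (affineNorm u)⁻¹ := continuous_affineNorm.measurable.inv
  ext s hs
  rw [Measure.map_apply hm hs, withDensity_apply _ (hm hs), Measure.smul_apply,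
    Measure.restrict_apply hs, smul_eq_mul, ← lintegral_indicator (hm hs)]
  have hr : Measurable fun r : ℝ => √(1 + r ^ 2) := by fun_prop
  have h1 : ∀ u : Plane, ((fun u : Plane => (affineNorm u)⁻¹) ⁻¹' s).indicator
      (fun u => ENNReal.ofReal (√(RP2.metric 2 u).det)) u =
      ENNReal.ofReal (√(1 + ‖u‖ ^ 2) ^ 3)⁻¹ * s.indicator 1 (√(1 + ‖u‖ ^ 2))⁻¹ := fun u => by
    rw [← affineNorm_eq]
    by_cases h : (affineNorm u)⁻¹ ∈ s
    · rw [indicator_of_mem (by exact h), indicator_of_mem h, sqrt_det_metric]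
      simp
    · rw [indicator_of_notMem (by exact h), indicator_of_notMem h, mul_zero]
  simp_rw [h1]
  rw [lintegral_fun_norm_addHaar volume (f := fun r : ℝ =>
    ENNReal.ofReal (√(1 + r ^ 2) ^ 3)⁻¹ * s.indicator 1 (√(1 + r ^ 2))⁻¹)
    ((ENNReal.measurable_ofReal.comp (hr.pow_const 3).inv).mul
      ((measurable_one.indicator hs).comp hr.inv))]
  congr 1
  rw [← Measure.restrict_apply hs, ← lintegral_indicator_one hs, lintegral_Ioo_eq_lintegral_Ioi]
  refine setLIntegral_congr_fun measurableSet_Ioi fun r hr => ?_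
  have hr' : (0 : ℝ) < r := hr
  simp only [finrank_euclideanSpace_fin, Nat.add_one_sub_one, pow_one]
  rw [← mul_assoc, ENNReal.ofReal_mul hr'.le]

theorem eLpNorm_comp_zonal {n : ℕ} (hn : Even n) {φ : ℝ → ℝ} (hφ : Continuous φ) (p : ENNReal) :
    eLpNorm (fun q => φ (zonal n q)) p RP2.area =
      eLpNorm (fun x => φ (legendre n x)) p
        ((volume : Measure Plane).toSphere univ • volume.restrict (Ioo (0 : ℝ) 1)) := by
  have hm : Measurable fun u : Plane => (affineNorm u)⁻¹ := continuous_affineNorm.measurable.inv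
  rw [RP2.area, eLpNorm_map_measure (g := fun q => φ (zonal n q)) (hφ.comp (continuous_zonal hn)).measurable.aestronglyMeasurable
    (RP2.continuous_param 2).measurable.aemeasurable, ← map_inv_affineNorm,
    eLpNorm_map_measure (g := fun x => φ (legendre n x)) (hφ.comp (continuous_legendre n)).measurable.aestronglyMeasurable
      hm.aemeasurable]
  congr 1
  funext u
  simp only [Function.comp_apply]
  rw [zonal_param hn, lift_apply, (affineVec_two_apply u).2.2, mul_one]

theorem restrict_Ioo_eq_smul_map {l : ℝ} (hl : 0 < l) :
    volume.restrict (Ioo (0 : ℝ) 1) = ENNReal.ofReal (2 / l) •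
      (volume.restrict (Ioo 0 (l / 2))).map fun y => 1 - 2 * (y / l) := by
  have ha : Measurable fun y : ℝ => 1 - 2 * (y / l) := by fun_prop
  have hpre : (fun y : ℝ => 1 - 2 * (y / l)) ⁻¹' Ioo 0 1 = Ioo 0 (l / 2) := by
    ext y
    simp only [mem_preimage, mem_Ioo]
    have e : 2 * (y / l) = y / (l / 2) := by field_simp
    rw [e, sub_pos, div_lt_one (by positivity), sub_lt_self_iff]
    constructor
    · rintro ⟨h1, h2⟩
      exact ⟨(div_pos_iff_of_pos_right (by positivity)).1 h2, h1⟩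
    · rintro ⟨h1, h2⟩
      exact ⟨h2, by positivity⟩
  have hvol : ENNReal.ofReal (2 / l) • (volume.map fun y : ℝ => 1 - 2 * (y / l)) = volume := by
    have h1 := Real.smul_map_volume_mul_left (a := 2 / l) (by positivity)
    rw [abs_of_pos (by positivity)] at h1
    have h2 := Measure.map_sub_left_eq_self volume (1 : ℝ)
    have e : (fun y : ℝ => 1 - 2 * (y / l)) = (fun y => 1 - y) ∘ fun y => 2 / l * y := by
      funext y
      simp only [Function.comp_apply]
      ring
    rw [e, ← Measure.map_map (by fun_prop) (by fun_prop), ← Measure.map_smul, h1, h2]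
  rw [← hpre, ← Measure.restrict_map ha measurableSet_Ioo, ← Measure.restrict_smul, hvol]

/-- The point is that C is the same for every φ, so it cancels between the positive and negative
parts, and the total mass of the circle need not be computed. The condition φ(0) = 0 makes the
cut-off at the equator harmless. -/
theorem exists_eLpNorm_comp_zonal_eq {n : ℕ} (hn0 : n ≠ 0) (hn : Even n) (p : ENNReal) :
    ∃ C : ENNReal, C ≠ 0 ∧ C ≠ ⊤ ∧ ∀ φ : ℝ → ℝ, Continuous φ → φ 0 = 0 →
      eLpNorm (fun q => φ (zonal n q)) p RP2.area =
        C * eLpNorm (fun y => φ (truncatedLegendre n y)) p (volume.restrict (Ioi 0)) := by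
  have hl : 0 < (n : ℝ) * (n + 1) := by positivity
  set c := (volume : Measure Plane).toSphere univ * ENNReal.ofReal (2 / ((n : ℝ) * (n + 1)))
    with hc
  have hs0 : (volume : Measure Plane).toSphere univ ≠ 0 := by
    rw [Measure.toSphere_apply_univ]
    exact mul_ne_zero (by simp) (measure_ball_pos _ _ one_pos).ne'
  have hc0 : c ≠ 0 := mul_ne_zero hs0 (ENNReal.ofReal_pos.2 (by positivity)).ne'
  have hct : c ≠ ⊤ := ENNReal.mul_ne_top (measure_ne_top _ _) ENNReal.ofReal_ne_top
  -- For p = ∞ the exponent is 0 and the constant is 1.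
  refine ⟨c ^ (1 / p).toReal, (ENNReal.rpow_pos (pos_iff_ne_zero.2 hc0) hct).ne',
    ENNReal.rpow_ne_top_of_nonneg ENNReal.toReal_nonneg hct, fun φ hφ h0 => ?_⟩
  have hind : (fun y => φ (truncatedLegendre n y)) =
      (Ioo (0 : ℝ) ((n : ℝ) * (n + 1) / 2)).indicator fun y => φ (rescaledLegendre n y) := by
    funext y
    by_cases hy : y ∈ Ioo (0 : ℝ) ((n : ℝ) * (n + 1) / 2)
    · rw [indicator_of_mem hy, truncatedLegendre, indicator_of_mem hy]
    · rw [indicator_of_notMem hy, truncatedLegendre, indicator_of_notMem hy, h0]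
  rw [eLpNorm_comp_zonal hn hφ, restrict_Ioo_eq_smul_map hl, smul_smul, ← hc,
    eLpNorm_smul_measure_of_ne_zero hc0, smul_eq_mul,
    eLpNorm_map_measure (g := fun x => φ (legendre n x)) (hφ.comp (continuous_legendre n)).measurable.aestronglyMeasurable
      (by fun_prop), hind, eLpNorm_indicator_eq_eLpNorm_restrict measurableSet_Ioo,
    Measure.restrict_restrict measurableSet_Ioo, inter_eq_left.2 Ioo_subset_Ioi_self]
  rfl

/-! ### Conclusion. -/

theorem corollary3p4 :
    ∃ (ψ : ℕ → RP2 → ℝ) (lam : ℕ → ℝ) (k : ℕ → ℕ),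
      StrictMono k ∧
      (∀ n (x : Metric.sphere (0 : Space) 1),
        ψ n (RP2.proj x) = legendre (4 * k n) ((x : Space) 2)) ∧
      (∀ n, RP2.IsLaplaceEigenfunction (ψ n) (lam n)) ∧
      Filter.Tendsto lam Filter.atTop Filter.atTop ∧
      ∀ p : ENNReal, 6 ≤ p →
        ∃ L : ℝ, 1 < L ∧
          Filter.Tendsto
            (fun n => RP2.lpNorm p (fun q => max (ψ n q) 0) /
              RP2.lpNorm p (fun q => max (-ψ n q) 0))
            Filter.atTop (nhds L) := by
  -- The degrees start at 4 because the rescaling divides by n(n+1), which is 0 in degree 0.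
  -- Evenness is all that the analysis takes from divisibility by 4.
  have he : ∀ n, Even (4 * (n + 1)) := fun n => ⟨2 * (n + 1), by ring⟩
  have hn : ∀ n, 4 * (n + 1) ≠ 0 := fun n => by omega
  have hd : Tendsto (fun n => 4 * (n + 1)) atTop atTop :=
    tendsto_atTop_mono (fun n => by simp only [id]; omega) tendsto_id
  refine ⟨fun n => zonal (4 * (n + 1)),
    fun n => ((4 * (n + 1) : ℕ) : ℝ) * (((4 * (n + 1) : ℕ) : ℝ) + 1), fun n => n + 1,
    fun a b h => Nat.add_lt_add_right h 1, fun n x => zonal_proj (he n) x,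
    fun n => isLaplaceEigenfunction_zonal (he n), ?_, fun p hp => ?_⟩
  · have h := (tendsto_mul_succ_half hd).atTop_mul_const two_pos
    exact h.congr fun n => by ring
  have hpos : LipschitzWith 1 fun t : ℝ => max t 0 := LipschitzWith.id.max_const 0
  have hneg : LipschitzWith 1 fun t : ℝ => max (-t) 0 := LipschitzWith.id.neg.max_const 0
  have tpos := tendsto_eLpNorm_comp hd hn he hpos (by simp) hp
  have tneg := tendsto_eLpNorm_comp hd hn he hneg (by simp) hp
  have fpos := (eLpNorm_comp_besselLimit_lt_top hpos (by simp) hp).ne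
  have fneg := (eLpNorm_comp_besselLimit_lt_top hneg (by simp) hp).ne
  have npos := ENNReal.toReal_pos (eLpNorm_besselLimit_negPart_pos hp).ne' fneg
  have hlt := (ENNReal.toReal_lt_toReal fneg fpos).2 (eLpNorm_besselLimit_negPart_lt hp)
  refine ⟨_, (one_lt_div npos).2 hlt, ?_⟩
  refine (((ENNReal.tendsto_toReal fpos).comp tpos).div
    ((ENNReal.tendsto_toReal fneg).comp tneg) npos.ne').congr fun n => ?_
  obtain ⟨C, hC0, hCt, hC⟩ := exists_eLpNorm_comp_zonal_eq (hn n) (he n) p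
  have hCr : C.toReal ≠ 0 := ENNReal.toReal_ne_zero.2 ⟨hC0, hCt⟩
  simp only [Pi.div_apply, Function.comp_apply, RP2.lpNorm]
  rw [hC _ hpos.continuous (by simp), hC _ hneg.continuous (by simp), ENNReal.toReal_mul,
    ENNReal.toReal_mul, mul_div_mul_left _ _ hCr]

end
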